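/- **Setting.** Let $G$ be a compact quantum group with compact quantum group algebra $A_G$ (a Hopf $*$-algebra generated by the matrix coefficients of its finite-dimensional unitary corepresentations), let $\mathrm{Rep}(G)$ be the monoidal dagger category of finite-dimensional unitary corepresentations of $A_G$ and intertwiners, let $\mathrm{Hilb}$ be the category of finite-dimensional Hilbert spaces and linear maps, and let $F:\mathrm{Rep}(G)\to\mathrm{Hilb}$ be the canonical (forgetful) fibre functor. Let $F':\mathrm{Rep}(G)\to\mathrm{Hilb}$ be any fibre functor, i.e. a faithful $\mathbb C$-linear monoidal functor with $F'(f^\dagger)=F'(f)^\dagger$ and unitary structure maps $\mu_{X,Y}:F'(X)\otimes F'(Y)\to F'(X\otimes Y)$, $\upsilon:\mathbb C\to F'(\mathbb 1)$. Let $(\alpha,H_e):F\to F'$ be a unitary pseudonatural transformation (UPT) with $H_e\neq 0$: a finite-dimensional Hilbert space $H_e$ and unitaries $\alpha_X:F(X)\otimes H_e\to H_e\otimes F'(X)$ such that $\alpha_Y(F(f)\otimes \mathrm{id})=(\mathrm{id}\otimes F'(f))\alpha_X$ for all $f:X\to Y$, $\alpha_{X\otimes Y}(\mu_{X,Y}\otimes\mathrm{id})=(\mathrm{id}\otimes\mu'_{X,Y})(\alpha_X\otimes\mathrm{id})(\mathrm{id}\otimes\alpha_Y)$,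 and $\alpha_{\mathbb 1}(\upsilon\otimes\mathrm{id})=\mathrm{id}\otimes\upsilon'$. Fix an orthonormal basis $\{|i\rangle\}$ of $H_e$, put $d=\dim H_e$, $\mathrm{cup}=\sum_i|i\rangle\otimes|i\rangle$ and $\mathrm{cap}=\mathrm{cup}^\dagger$, and define $a^X_{ij}:F(X)\to F'(X)$ by $\alpha_X(x\otimes|j\rangle)=\sum_i|i\rangle\otimes a^X_{ij}x$. The dual $\alpha^*$ of $\alpha$ has components $\alpha^*_X:F'(X)\otimes H_e\to H_e\otimes F(X)$ obtained from $\alpha_X^\dagger$ by bending both $H_e$-legs with the cup and cap; that is, $\alpha^*_X(y\otimes|j\rangle)=\sum_i|i\rangle\otimes(a^X_{ij})^\dagger y$. **Algebras.** A Frobenius algebra $[A,m,u]$ in a monoidal dagger category is an associative unital algebra with $(m\otimes\mathrm{id})(\mathrm{id}\otimes m^\dagger)=m^\dagger m=(\mathrm{id}\otimes m)(m^\dagger\otimes\mathrm{id})$. It has the cup $m^\dagger u$ and the cap $u^\dagger m$; it is *special* if $mm^\dagger=\mathrm{id}$ and *standard* if $u^\dagger m(f\otimes \mathrm{id})m^\dagger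 u=u^\dagger m(\mathrm{id}\otimes f)m^\dagger u$ for all $f\in\mathrm{End}(A)$. An SSFA is a standard special Frobenius algebra. A morphism $f:A\to B$ of Frobenius algebras is a *$*$-cohomomorphism* if $m_B^\dagger f=(f\otimes f)m_A^\dagger$, $u_B^\dagger f=u_A^\dagger$ and $f^\dagger=(\mathrm{id}_A\otimes u_B^\dagger m_B)(\mathrm{id}_A\otimes f\otimes\mathrm{id}_B)(m_A^\dagger u_A\otimes\mathrm{id}_B)$ (in $\mathrm{Hilb}$ the last condition says that $f$ preserves the involution); it is *CP* if $(\mathrm{id}_A\otimes m_B)(\mathrm{id}_A\otimes f\otimes\mathrm{id}_B)(m_A^\dagger\otimes\mathrm{id}_B)=g^\dagger g$ for some object $X$ and some $g:A\otimes B\to X$, and a *channel* if it is CP and $u_B^\dagger f=u_A^\dagger$. Write $F([A,m,u])=[F(A),F(m)\mu_{A,A},F(u)\upsilon]$, and likewise for $F'$. The algebra $B(H_e)$ is $H_e\otimes H_e$ with multiplication $\tfrac1{\sqrt d}(\mathrm{id}\otimes\mathrm{cap}\otimes\mathrm{id})$ and unit $\sqrt d\,\mathrm{cup}$; tensor products of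 algebras in $\mathrm{Hilb}$ are formed with the swap. The maximally entangled state is $\Psi:\mathbb C\to B(H_e)\otimes B(H_e)$, $\Psi(1)=\tfrac1{d^2}\sum_{i,j}(|i\rangle\otimes|j\rangle)\otimes(|i\rangle\otimes|j\rangle)$. **Theorem.** For every SSFA $[A,m,u]$ in $\mathrm{Rep}(G)$ define linear maps $$u_A: F(A)\otimes B(H_e)\to F'(A),\quad u_A(x\otimes|j\rangle\otimes|k\rangle)=\sqrt d\;a^A_{jk}\,x,$$ $$v_A: F'(A)\otimes B(H_e)\to F(A),\quad v_A(y\otimes|j\rangle\otimes|k\rangle)=\sqrt d\;(a^A_{jk})^\dagger y,$$ i.e. $u_A$ (resp. $v_A$) is $\sqrt d$ times the map obtained by feeding the second leg of $B(H_e)=H_e\otimes H_e$ into $\alpha_A$ (resp. $\alpha^*_A$) and contracting the outgoing $H_e$-leg with the first leg of $B(H_e)$. Then: 1. $F([A,m,u])$, $F'([A,m,u])$, $B(H_e)$, $F([A,m,u])\otimes B(H_e)$ and $F'([A,m,u])\otimes B(H_e)$ are special Frobenius algebras in $\mathrm{Hilb}$, and $u_A: F([A,m,u])\otimes B(H_e)\to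 F'([A,m,u])$ and $v_A: F'([A,m,u])\otimes B(H_e)\to F([A,m,u])$ are $*$-cohomomorphisms, and channels. 2. (Entanglement-invertibility.) $v_A\circ(u_A\otimes\mathrm{id}_{B(H_e)})\circ(\mathrm{id}_{F(A)}\otimes\Psi)=\mathrm{id}_{F(A)}$ and $u_A\circ(v_A\otimes\mathrm{id}_{B(H_e)})\circ(\mathrm{id}_{F'(A)}\otimes\Psi)=\mathrm{id}_{F'(A)}$. 3. (Naturality.) For all SSFAs $A_1,A_2$ in $\mathrm{Rep}(G)$ and every CP morphism $f:A_1\to A_2$, $F'(f)\circ u_{A_1}=u_{A_2}\circ(F(f)\otimes\mathrm{id}_{B(H_e)})$ and $F(f)\circ v_{A_1}=v_{A_2}\circ(F'(f)\otimes\mathrm{id}_{B(H_e)})$. -/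

import Mathlib

open CategoryTheory MonoidalCategory TensorProduct
open scoped InnerProductSpace

noncomputable section

namespace EntSymm

universe u v

/-! ### Dagger categories -/

/-- A dagger category: an involutive contravariant operation on morphisms which is the identity
on objects. -/
class DaggerCategory (C : Type u) [Category.{v} C] where
  dagger : ∀ {X Y : C}, (X ⟶ Y) → (Y ⟶ X)
  dagger_id : ∀ X : C, dagger (𝟙 X) = 𝟙 X
  dagger_comp : ∀ {X Y Z : C} (f : X ⟶ Y) (g : Y ⟶ Z), dagger (f ≫ g) = dagger g ≫ dagger f
  dagger_dagger : ∀ {X Y : C} (f : X ⟶ Y), dagger (dagger f) = f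

/-- The dagger `f†` of a morphism. -/
abbrev dag {C : Type u} [Category.{v} C] [DaggerCategory C] {X Y : C} (f : X ⟶ Y) : Y ⟶ X :=
  DaggerCategory.dagger f

/-- Unitary morphisms of a dagger category. -/
def IsUnitary {C : Type u} [Category.{v} C] [DaggerCategory C] {X Y : C} (f : X ⟶ Y) : Prop :=
  f ≫ dag f = 𝟙 X ∧ dag f ≫ f = 𝟙 Y

/-! ### The category of finite-dimensional Hilbert spaces -/

/-- Finite-dimensional complex Hilbert spaces. -/
structure FHilb where
  carrier : Type
  [normedAddCommGroup : NormedAddCommGroup carrier]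
  [innerProductSpace : InnerProductSpace ℂ carrier]
  [finiteDimensional : FiniteDimensional ℂ carrier]

namespace FHilb

instance : CoeSort FHilb Type := ⟨FHilb.carrier⟩

attribute [instance] normedAddCommGroup innerProductSpace finiteDimensional

/-- Morphisms of `FHilb` are all linear maps. -/
@[ext] structure Hom (V W : FHilb) where
  lin : V →ₗ[ℂ] W

instance : Category FHilb where
  Hom V W := Hom V W
  id V := ⟨LinearMap.id⟩
  comp f g := ⟨g.lin ∘ₗ f.lin⟩

@[ext] lemma hom_ext {V W : FHilb} {f g : V ⟶ W} (h : f.lin = g.lin) : f = g := Hom.ext h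

@[simp] lemma id_lin (V : FHilb) : Hom.lin (𝟙 V) = LinearMap.id := rfl

@[simp] lemma comp_lin {V W X : FHilb} (f : V ⟶ W) (g : W ⟶ X) :
    (f ≫ g).lin = g.lin ∘ₗ f.lin := rfl

lemma lin_injective (V W : FHilb) : Function.Injective (fun f : V ⟶ W => f.lin) :=
  fun _ _ h => hom_ext h

instance (V W : FHilb) : Zero (V ⟶ W) := ⟨⟨0⟩⟩
instance (V W : FHilb) : Add (V ⟶ W) := ⟨fun f g => ⟨f.lin + g.lin⟩⟩
instance (V W : FHilb) : Neg (V ⟶ W) := ⟨fun f => ⟨-f.lin⟩⟩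
instance (V W : FHilb) : Sub (V ⟶ W) := ⟨fun f g => ⟨f.lin - g.lin⟩⟩
instance (V W : FHilb) : SMul ℕ (V ⟶ W) := ⟨fun n f => ⟨n • f.lin⟩⟩
instance (V W : FHilb) : SMul ℤ (V ⟶ W) := ⟨fun n f => ⟨n • f.lin⟩⟩
instance (V W : FHilb) : SMul ℂ (V ⟶ W) := ⟨fun c f => ⟨c • f.lin⟩⟩

@[simp] lemma zero_lin (V W : FHilb) : Hom.lin (0 : V ⟶ W) = 0 := rfl
@[simp] lemma add_lin {V W : FHilb} (f g : V ⟶ W) : Hom.lin (f + g) = f.lin + g.lin := rfl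
@[simp] lemma smul_lin {V W : FHilb} (c : ℂ) (f : V ⟶ W) : Hom.lin (c • f) = c • f.lin := rfl

instance (V W : FHilb) : AddCommGroup (V ⟶ W) :=
  (lin_injective V W).addCommGroup _ rfl (fun _ _ => rfl) (fun _ => rfl) (fun _ _ => rfl)
    (fun _ _ => rfl) (fun _ _ => rfl)

instance : Preadditive FHilb where
  add_comp := by intros; ext x; simp
  comp_add := by intros; ext x; simp

instance (V W : FHilb) : Module ℂ (V ⟶ W) :=
  Function.Injective.module ℂ ⟨⟨fun f : V ⟶ W => f.lin, rfl⟩, fun _ _ => rfl⟩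
    (lin_injective V W) (fun _ _ => rfl)

instance : Linear ℂ FHilb where
  smul_comp := by intros; ext x; simp
  comp_smul := by intros; ext x; simp

/-- A linear equivalence as an isomorphism in `FHilb`. -/
def isoOfEquiv {V W : FHilb} (e : V ≃ₗ[ℂ] W) : V ≅ W where
  hom := ⟨e.toLinearMap⟩
  inv := ⟨e.symm.toLinearMap⟩
  hom_inv_id := by ext x; simp
  inv_hom_id := by ext x; simp

instance : MonoidalCategoryStruct FHilb where
  tensorObj V W := ⟨V ⊗[ℂ] W⟩
  whiskerLeft V _ _ f := ⟨f.lin.lTensor V⟩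
  whiskerRight f W := ⟨f.lin.rTensor W⟩
  tensorHom f g := ⟨TensorProduct.map f.lin g.lin⟩
  tensorUnit := ⟨ℂ⟩
  associator V W X := isoOfEquiv (TensorProduct.assoc ℂ V W X)
  leftUnitor V := isoOfEquiv (TensorProduct.lid ℂ V)
  rightUnitor V := isoOfEquiv (TensorProduct.rid ℂ V)

@[simp] lemma whiskerLeft_lin (V : FHilb) {W X : FHilb} (f : W ⟶ X) :
    (V ◁ f).lin = f.lin.lTensor V := rfl
@[simp] lemma whiskerRight_lin {W X : FHilb} (f : W ⟶ X) (V : FHilb) :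
    (f ▷ V).lin = f.lin.rTensor V := rfl
@[simp] lemma tensorHom_lin {V W X Y : FHilb} (f : V ⟶ W) (g : X ⟶ Y) :
    (f ⊗ₘ g).lin = TensorProduct.map f.lin g.lin := rfl
@[simp] lemma associator_hom_lin (V W X : FHilb) :
    (α_ V W X).hom.lin = (TensorProduct.assoc ℂ V W X).toLinearMap := rfl
@[simp] lemma associator_inv_lin (V W X : FHilb) :
    (α_ V W X).inv.lin = (TensorProduct.assoc ℂ V W X).symm.toLinearMap := rfl
@[simp] lemma leftUnitor_hom_lin (V : FHilb) :
    (λ_ V).hom.lin = (TensorProduct.lid ℂ V).toLinearMap := rfl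
@[simp] lemma leftUnitor_inv_lin (V : FHilb) :
    (λ_ V).inv.lin = (TensorProduct.lid ℂ V).symm.toLinearMap := rfl
@[simp] lemma rightUnitor_hom_lin (V : FHilb) :
    (ρ_ V).hom.lin = (TensorProduct.rid ℂ V).toLinearMap := rfl
@[simp] lemma rightUnitor_inv_lin (V : FHilb) :
    (ρ_ V).inv.lin = (TensorProduct.rid ℂ V).symm.toLinearMap := rfl

instance : MonoidalCategory FHilb where
  tensorHom_def _ _ := hom_ext (TensorProduct.ext' fun _ _ => rfl)
  id_tensorHom_id _ _ := hom_ext (TensorProduct.ext' fun _ _ => rfl)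
  tensorHom_comp_tensorHom _ _ _ _ := hom_ext (TensorProduct.ext' fun _ _ => rfl)
  whiskerLeft_id _ _ := hom_ext (TensorProduct.ext' fun _ _ => rfl)
  id_whiskerRight _ _ := hom_ext (TensorProduct.ext' fun _ _ => rfl)
  associator_naturality _ _ _ := hom_ext (TensorProduct.ext_threefold fun _ _ _ => rfl)
  leftUnitor_naturality f := hom_ext (TensorProduct.ext' fun c x => (f.lin.map_smul c x).symm)
  rightUnitor_naturality f := hom_ext (TensorProduct.ext' fun x c => (f.lin.map_smul c x).symm)
  pentagon _ _ _ _ := hom_ext (TensorProduct.ext_fourfold fun _ _ _ _ => rfl)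
  triangle _ _ := hom_ext (TensorProduct.ext_threefold fun x (c : ℂ) y =>
    (TensorProduct.smul_tmul c x y).symm)

/-- The swap maps. -/
instance : BraidedCategory FHilb where
  braiding V W := isoOfEquiv (TensorProduct.comm ℂ V W)
  braiding_naturality_right _ _ _ _ := hom_ext (TensorProduct.ext' fun _ _ => rfl)
  braiding_naturality_left _ _ := hom_ext (TensorProduct.ext' fun _ _ => rfl)
  hexagon_forward _ _ _ := hom_ext (TensorProduct.ext_threefold fun _ _ _ => rfl)
  hexagon_reverse _ _ _ := hom_ext (TensorProduct.ext (LinearMap.ext fun _ =>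
    TensorProduct.ext' fun _ _ => rfl))

@[simp] lemma braiding_hom_lin (V W : FHilb) :
    (β_ V W).hom.lin = (TensorProduct.comm ℂ V W).toLinearMap := rfl

/-- The dagger is the Hermitian adjoint. -/
instance : DaggerCategory FHilb where
  dagger f := ⟨LinearMap.adjoint f.lin⟩
  dagger_id _ := hom_ext (LinearMap.adjoint_id)
  dagger_comp _ _ := hom_ext (LinearMap.adjoint_comp _ _)
  dagger_dagger _ := hom_ext (LinearMap.adjoint_adjoint _)

@[simp] lemma dag_lin {V W : FHilb} (f : V ⟶ W) : (dag f).lin = LinearMap.adjoint f.lin := rfl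

end FHilb

/-! ### Compact quantum group algebras and their unitary corepresentations -/

section Corep

variable {𝒜 : Type u} [Ring 𝒜] [StarRing 𝒜] [HopfAlgebra ℂ 𝒜] [StarModule ℂ 𝒜]

set_option linter.unusedSectionVars false

section Coeff

variable {V W : Type} [NormedAddCommGroup V] [InnerProductSpace ℂ V]
  [NormedAddCommGroup W] [InnerProductSpace ℂ W]

/-- `(⟨x| ⊗ id) t`. -/
def slice {M : Type*} [AddCommGroup M] [Module ℂ M] (x : V) (t : V ⊗[ℂ] M) : M :=
  TensorProduct.lid ℂ M ((innerₛₗ ℂ x).rTensor M t)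

/-- The matrix coefficient `(⟨x| ⊗ id) (δ y)` of a linear map `δ : V → V ⊗ 𝒜`. -/
def coeff (δ : V →ₗ[ℂ] V ⊗[ℂ] 𝒜) (x y : V) : 𝒜 := slice x (δ y)

/-- Unitarity of a corepresentation: in every orthonormal basis the matrix of coefficients is
unitary. -/
def IsUnitaryCoeff (δ : V →ₗ[ℂ] V ⊗[ℂ] 𝒜) : Prop :=
  ∀ (n : ℕ) (b : OrthonormalBasis (Fin n) ℂ V) (i k : Fin n),
    ∑ j, star (coeff δ (b j) (b i)) * coeff δ (b j) (b k) = (if i = k then 1 else 0) ∧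
    ∑ j, coeff δ (b i) (b j) * star (coeff δ (b k) (b j)) = (if i = k then 1 else 0)

/-- A unitary corepresentation `δ : V → V ⊗ 𝒜`. -/
structure IsUnitaryCorep (δ : V →ₗ[ℂ] V ⊗[ℂ] 𝒜) : Prop where
  coassoc : (TensorProduct.assoc ℂ V 𝒜 𝒜).toLinearMap ∘ₗ δ.rTensor 𝒜 ∘ₗ δ =
    (Coalgebra.comul (R := ℂ) (A := 𝒜)).lTensor V ∘ₗ δ
  counit : (TensorProduct.rid ℂ V).toLinearMap ∘ₗ
    (Coalgebra.counit (R := ℂ) (A := 𝒜)).lTensor V ∘ₗ δ = LinearMap.id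
  unitary : IsUnitaryCoeff δ

section Slice

variable {M : Type*} [AddCommGroup M] [Module ℂ M]

@[simp] lemma slice_tmul (x v : V) (a : M) : slice x (v ⊗ₜ[ℂ] a) = ⟪x, v⟫_ℂ • a := by
  simp [slice]

@[simp] lemma slice_add_right (x : V) (s t : V ⊗[ℂ] M) :
    slice x (s + t) = slice x s + slice x t := by simp [slice]

@[simp] lemma slice_smul_right (x : V) (c : ℂ) (t : V ⊗[ℂ] M) :
    slice x (c • t) = c • slice x t := by simp [slice]

@[simp] lemma slice_zero_right (x : V) : slice x (0 : V ⊗[ℂ] M) = 0 := by simp [slice]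

lemma slice_add_left (x y : V) (t : V ⊗[ℂ] M) :
    slice (x + y) t = slice x t + slice y t := by
  simp [slice, LinearMap.rTensor_add]

lemma slice_smul_left (c : ℂ) (x : V) (t : V ⊗[ℂ] M) :
    slice (c • x) t = star c • slice x t := by
  simp [slice, LinearMap.rTensor_smul]

lemma sum_tmul_slice {ι : Type*} [Fintype ι] (b : OrthonormalBasis ι ℂ V) (t : V ⊗[ℂ] M) :
    ∑ j, b j ⊗ₜ[ℂ] slice (b j) t = t := by
  induction t with
  | zero => simp
  | add s t hs ht =>
    simp only [slice_add_right, TensorProduct.tmul_add, Finset.sum_add_distrib, hs, ht]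
  | tmul v a =>
    simp only [slice_tmul, ← TensorProduct.smul_tmul, ← TensorProduct.sum_tmul]
    rw [b.sum_repr' v]

lemma slice_ext [FiniteDimensional ℂ V] {s t : V ⊗[ℂ] M} (h : ∀ x, slice x s = slice x t) :
    s = t := by
  rw [← sum_tmul_slice (stdOrthonormalBasis ℂ V) s, ← sum_tmul_slice (stdOrthonormalBasis ℂ V) t]
  simp only [h]

end Slice

/-- `coeff` as a sesquilinear map. -/
def coeffₛₗ (δ : V →ₗ[ℂ] V ⊗[ℂ] 𝒜) : V →ₗ⋆[ℂ] V →ₗ[ℂ] 𝒜 :=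
  LinearMap.mk₂'ₛₗ _ _ (coeff δ) (fun _ _ _ => slice_add_left _ _ _)
    (fun _ _ _ => slice_smul_left _ _ _) (fun _ _ _ => by simp [coeff])
    (fun _ _ _ => by simp [coeff])

lemma coeffₛₗ_apply (δ : V →ₗ[ℂ] V ⊗[ℂ] 𝒜) (x y : V) : coeffₛₗ δ x y = coeff δ x y := rfl

lemma sum_sesq {M : Type*} [AddCommGroup M] [Module ℂ M] {ι κ : Type*} [Fintype ι] [Fintype κ]
    (b : OrthonormalBasis ι ℂ V) (b' : OrthonormalBasis κ ℂ V) (B : V →ₗ⋆[ℂ] V →ₗ[ℂ] M) :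
    ∑ j, B (b j) (b j) = ∑ k, B (b' k) (b' k) := by
  have h1 : ∀ j, B (b j) (b j) = ∑ k, B (⟪b j, b' k⟫_ℂ • b j) (b' k) := by
    intro j
    conv_lhs => enter [2]; rw [← b'.sum_repr' (b j)]
    simp
  have h2 : ∀ k, B (b' k) (b' k) = ∑ j, B (⟪b j, b' k⟫_ℂ • b j) (b' k) := by
    intro k
    conv_lhs => enter [1, 2]; rw [← b.sum_repr' (b' k)]
    rw [map_sum, LinearMap.sum_apply]
  simp only [h1, h2]
  exact Finset.sum_comm

lemma sum_star_mul (δ : V →ₗ[ℂ] V ⊗[ℂ] 𝒜) {ι : Type*} [Fintype ι] [DecidableEq ι]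
    (b : OrthonormalBasis ι ℂ V)
    (h : ∀ i k, ∑ j, star (coeff δ (b j) (b i)) * coeff δ (b j) (b k) = if i = k then 1 else 0)
    {κ : Type*} [Fintype κ] (b' : OrthonormalBasis κ ℂ V) (x y : V) :
    ∑ j, star (coeff δ (b' j) x) * coeff δ (b' j) y = ⟪x, y⟫_ℂ • (1 : 𝒜) := by
  let B : V →ₗ⋆[ℂ] V →ₗ[ℂ] 𝒜 := LinearMap.mk₂'ₛₗ _ _
    (fun u w => star (coeff δ w x) * coeff δ u y)
    (fun _ _ _ => by simp only [← coeffₛₗ_apply]; simp [mul_add])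
    (fun _ _ _ => by simp only [← coeffₛₗ_apply]; simp)
    (fun _ _ _ => by simp only [← coeffₛₗ_apply]; simp [add_mul])
    (fun _ _ _ => by simp only [← coeffₛₗ_apply]; simp)
  have hB := sum_sesq b' b B
  simp only [B, LinearMap.mk₂'ₛₗ_apply] at hB
  rw [hB]
  have hx : ∀ j, star (coeff δ (b j) x) = ∑ i, ⟪x, b i⟫_ℂ • star (coeff δ (b j) (b i)) := by
    intro j
    conv_lhs => rw [← b.sum_repr' x]
    simp only [← coeffₛₗ_apply]
    simp [star_sum]
  have hy : ∀ j, coeff δ (b j) y = ∑ k, ⟪b k, y⟫_ℂ • coeff δ (b j) (b k) := by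
    intro j
    conv_lhs => rw [← b.sum_repr' y]
    simp only [← coeffₛₗ_apply]
    simp
  simp only [hx, hy, Finset.sum_mul_sum, smul_mul_smul_comm]
  rw [Finset.sum_comm]
  have : ∀ i, ∑ j, ∑ k, (⟪x, b i⟫_ℂ * ⟪b k, y⟫_ℂ) •
      (star (coeff δ (b j) (b i)) * coeff δ (b j) (b k)) =
      (⟪x, b i⟫_ℂ * ⟪b i, y⟫_ℂ) • (1 : 𝒜) := by
    intro i
    rw [Finset.sum_comm]
    simp only [← Finset.smul_sum, h]
    simp
  simp only [this, ← Finset.sum_smul, b.sum_inner_mul_inner]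

lemma sum_mul_star (δ : V →ₗ[ℂ] V ⊗[ℂ] 𝒜) {ι : Type*} [Fintype ι] [DecidableEq ι]
    (b : OrthonormalBasis ι ℂ V)
    (h : ∀ i k, ∑ j, coeff δ (b i) (b j) * star (coeff δ (b k) (b j)) = if i = k then 1 else 0)
    {κ : Type*} [Fintype κ] (b' : OrthonormalBasis κ ℂ V) (x y : V) :
    ∑ j, coeff δ x (b' j) * star (coeff δ y (b' j)) = ⟪x, y⟫_ℂ • (1 : 𝒜) := by
  let B : V →ₗ⋆[ℂ] V →ₗ[ℂ] 𝒜 := LinearMap.mk₂'ₛₗ _ _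
    (fun u w => coeff δ x w * star (coeff δ y u))
    (fun _ _ _ => by simp only [← coeffₛₗ_apply]; simp [mul_add])
    (fun _ _ _ => by simp only [← coeffₛₗ_apply]; simp)
    (fun _ _ _ => by simp only [← coeffₛₗ_apply]; simp [add_mul])
    (fun _ _ _ => by simp only [← coeffₛₗ_apply]; simp)
  have hB := sum_sesq b' b B
  simp only [B, LinearMap.mk₂'ₛₗ_apply] at hB
  rw [hB]
  have hx : ∀ j, coeff δ x (b j) = ∑ i, ⟪x, b i⟫_ℂ • coeff δ (b i) (b j) := by
    intro j
    conv_lhs => rw [← b.sum_repr' x]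
    simp only [← coeffₛₗ_apply]
    simp
  have hy : ∀ j, star (coeff δ y (b j)) = ∑ k, ⟪b k, y⟫_ℂ • star (coeff δ (b k) (b j)) := by
    intro j
    conv_lhs => rw [← b.sum_repr' y]
    simp only [← coeffₛₗ_apply]
    simp [star_sum]
  simp only [hx, hy, Finset.sum_mul_sum, smul_mul_smul_comm]
  rw [Finset.sum_comm]
  have : ∀ i, ∑ j, ∑ k, (⟪x, b i⟫_ℂ * ⟪b k, y⟫_ℂ) •
      (coeff δ (b i) (b j) * star (coeff δ (b k) (b j))) =
      (⟪x, b i⟫_ℂ * ⟪b i, y⟫_ℂ) • (1 : 𝒜) := by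
    intro i
    rw [Finset.sum_comm]
    simp only [← Finset.smul_sum, h]
    simp
  simp only [this, ← Finset.sum_smul, b.sum_inner_mul_inner]

lemma isUnitaryCoeff_of_basis (δ : V →ₗ[ℂ] V ⊗[ℂ] 𝒜) {ι : Type*} [Fintype ι] [DecidableEq ι]
    (b : OrthonormalBasis ι ℂ V)
    (h1 : ∀ i k, ∑ j, star (coeff δ (b j) (b i)) * coeff δ (b j) (b k) = if i = k then 1 else 0)
    (h2 : ∀ i k, ∑ j, coeff δ (b i) (b j) * star (coeff δ (b k) (b j)) = if i = k then 1 else 0) :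
    IsUnitaryCoeff δ := by
  intro n b' i k
  rw [sum_star_mul δ b h1 b', sum_mul_star δ b h2 b', b'.inner_eq_ite]
  split_ifs <;> simp

variable [FiniteDimensional ℂ V] [FiniteDimensional ℂ W]

lemma IsUnitaryCoeff.star_mul {δ : V →ₗ[ℂ] V ⊗[ℂ] 𝒜} (h : IsUnitaryCoeff δ)
    {κ : Type*} [Fintype κ] (b : OrthonormalBasis κ ℂ V) (x y : V) :
    ∑ j, star (coeff δ (b j) x) * coeff δ (b j) y = ⟪x, y⟫_ℂ • (1 : 𝒜) :=
  sum_star_mul δ (stdOrthonormalBasis ℂ V) (fun i k => (h _ _ i k).1) b x y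

lemma IsUnitaryCoeff.mul_star {δ : V →ₗ[ℂ] V ⊗[ℂ] 𝒜} (h : IsUnitaryCoeff δ)
    {κ : Type*} [Fintype κ] (b : OrthonormalBasis κ ℂ V) (x y : V) :
    ∑ j, coeff δ x (b j) * star (coeff δ y (b j)) = ⟪x, y⟫_ℂ • (1 : 𝒜) :=
  sum_mul_star δ (stdOrthonormalBasis ℂ V) (fun i k => (h _ _ i k).2) b x y

lemma intertwiner_iff (δ : V →ₗ[ℂ] V ⊗[ℂ] 𝒜) (γ : W →ₗ[ℂ] W ⊗[ℂ] 𝒜) (f : V →ₗ[ℂ] W) :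
    γ ∘ₗ f = f.rTensor 𝒜 ∘ₗ δ ↔
      ∀ x y, coeff γ x (f y) = coeff δ (LinearMap.adjoint f x) y := by
  have key : ∀ (x : W) (t : V ⊗[ℂ] 𝒜),
      slice x (f.rTensor 𝒜 t) = slice (LinearMap.adjoint f x) t := by
    intro x t
    induction t with
    | zero => simp
    | add s t hs ht => simp [hs, ht]
    | tmul v a => simp [LinearMap.adjoint_inner_left]
  constructor
  · intro h x y
    have := congrArg (slice x) (LinearMap.congr_fun h y)
    simpa [key, coeff] using this
  · intro h
    ext y
    refine slice_ext fun x => ?_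
    simpa [key, coeff] using h x y

lemma intertwiner_adjoint {δ : V →ₗ[ℂ] V ⊗[ℂ] 𝒜} {γ : W →ₗ[ℂ] W ⊗[ℂ] 𝒜}
    (hδ : IsUnitaryCoeff δ) (hγ : IsUnitaryCoeff γ) {f : V →ₗ[ℂ] W}
    (h : γ ∘ₗ f = f.rTensor 𝒜 ∘ₗ δ) :
    δ ∘ₗ LinearMap.adjoint f = (LinearMap.adjoint f).rTensor 𝒜 ∘ₗ γ := by
  rw [intertwiner_iff] at h ⊢
  intro y x
  rw [LinearMap.adjoint_adjoint]
  let v := stdOrthonormalBasis ℂ V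
  let w := stdOrthonormalBasis ℂ W
  have e1 : ∑ k, (∑ j, star (coeff γ (w j) x) * coeff γ (w j) (f (v k))) * star (coeff δ y (v k))
      = star (coeff δ y (LinearMap.adjoint f x)) := by
    simp only [hγ.star_mul w]
    conv_rhs => rw [← v.sum_repr' (LinearMap.adjoint f x)]
    simp only [← coeffₛₗ_apply]
    simp [star_sum, LinearMap.adjoint_inner_right]
  have e2 : ∑ j, star (coeff γ (w j) x) * (∑ k, coeff γ (w j) (f (v k)) * star (coeff δ y (v k)))
      = star (coeff γ (f y) x) := by
    simp only [h, hδ.mul_star v, LinearMap.adjoint_inner_left]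
    conv_rhs => rw [← w.sum_repr' (f y)]
    simp only [← coeffₛₗ_apply]
    simp [star_sum]
  have e3 := e1.symm.trans (Eq.trans ?_ e2)
  · exact star_injective e3
  · simp only [Finset.sum_mul, Finset.mul_sum, mul_assoc]
    exact Finset.sum_comm

lemma coassoc_iff (δ : V →ₗ[ℂ] V ⊗[ℂ] 𝒜) {ι : Type*} [Fintype ι] (b : OrthonormalBasis ι ℂ V) :
    (TensorProduct.assoc ℂ V 𝒜 𝒜).toLinearMap ∘ₗ δ.rTensor 𝒜 ∘ₗ δ =
      (Coalgebra.comul (R := ℂ) (A := 𝒜)).lTensor V ∘ₗ δ ↔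
    ∀ x y, Coalgebra.comul (R := ℂ) (coeff δ x y) =
      ∑ j, coeff δ x (b j) ⊗ₜ[ℂ] coeff δ (b j) y := by
  have key1 : ∀ (x : V) (y : V), slice x (TensorProduct.assoc ℂ V 𝒜 𝒜 (δ.rTensor 𝒜 (δ y))) =
      ∑ j, coeff δ x (b j) ⊗ₜ[ℂ] coeff δ (b j) y := by
    intro x y
    have h0 : ∀ (t : V ⊗[ℂ] 𝒜) (a : 𝒜),
        slice x (TensorProduct.assoc ℂ V 𝒜 𝒜 (t ⊗ₜ[ℂ] a)) = slice x t ⊗ₜ[ℂ] a := by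
      intro t a
      induction t with
      | zero => simp
      | add s t hs ht => simp [TensorProduct.add_tmul, hs, ht]
      | tmul v c => simp [TensorProduct.smul_tmul']
    have hadd : ∀ s : Finset ι, ∀ g : ι → V ⊗[ℂ] (𝒜 ⊗[ℂ] 𝒜),
        slice x (∑ j ∈ s, g j) = ∑ j ∈ s, slice x (g j) := by
      intro s g
      simp [slice]
    conv_lhs => rw [← sum_tmul_slice b (δ y)]
    rw [map_sum, map_sum, hadd]
    simp only [LinearMap.rTensor_tmul, h0]
    rfl
  have key2 : ∀ (x : V) (t : V ⊗[ℂ] 𝒜),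
      slice x ((Coalgebra.comul (R := ℂ) (A := 𝒜)).lTensor V t) =
      Coalgebra.comul (R := ℂ) (slice x t) := by
    intro x t
    induction t with
    | zero => simp
    | add s t hs ht => simp [hs, ht]
    | tmul v a => simp
  constructor
  · intro h x y
    have := congrArg (slice x) (LinearMap.congr_fun h y)
    simp only [LinearMap.comp_apply, LinearEquiv.coe_coe, key1, key2] at this
    exact this.symm
  · intro h
    refine LinearMap.ext fun y => slice_ext fun x => ?_
    simp only [LinearMap.comp_apply, LinearEquiv.coe_coe, key1, key2]
    exact (h x y).symm

lemma counit_iff (δ : V →ₗ[ℂ] V ⊗[ℂ] 𝒜) :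
    (TensorProduct.rid ℂ V).toLinearMap ∘ₗ
      (Coalgebra.counit (R := ℂ) (A := 𝒜)).lTensor V ∘ₗ δ = LinearMap.id ↔
    ∀ x y, Coalgebra.counit (R := ℂ) (coeff δ x y) = ⟪x, y⟫_ℂ := by
  have key : ∀ (x : V) (t : V ⊗[ℂ] 𝒜), ⟪x, TensorProduct.rid ℂ V
      ((Coalgebra.counit (R := ℂ) (A := 𝒜)).lTensor V t)⟫_ℂ =
      Coalgebra.counit (R := ℂ) (slice x t) := by
    intro x t
    induction t with
    | zero => simp
    | add s t hs ht => simp [hs, ht]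
    | tmul v a => simp [mul_comm]
  constructor
  · intro h x y
    have := congrArg (fun z => ⟪x, z⟫_ℂ) (LinearMap.congr_fun h y)
    simp only [LinearMap.comp_apply, LinearEquiv.coe_coe, key] at this
    exact this
  · intro h
    ext y
    refine ext_inner_left ℂ fun x => ?_
    simp only [LinearMap.comp_apply, LinearEquiv.coe_coe, key]
    exact h x y

/-- The coaction of a tensor product, `v ⊗ w ↦ v₀ ⊗ w₀ ⊗ v₁ w₁`. -/
def tensorCoaction (δ : V →ₗ[ℂ] V ⊗[ℂ] 𝒜) (γ : W →ₗ[ℂ] W ⊗[ℂ] 𝒜) :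
    (V ⊗[ℂ] W) →ₗ[ℂ] (V ⊗[ℂ] W) ⊗[ℂ] 𝒜 :=
  (LinearMap.mul' ℂ 𝒜).lTensor (V ⊗[ℂ] W) ∘ₗ
    (TensorProduct.tensorTensorTensorComm ℂ V 𝒜 W 𝒜).toLinearMap ∘ₗ TensorProduct.map δ γ

/-- The trivial coaction `v ↦ v ⊗ 1`. -/
def trivialCoaction (V : Type) [NormedAddCommGroup V] [InnerProductSpace ℂ V] :
    V →ₗ[ℂ] V ⊗[ℂ] 𝒜 := (TensorProduct.mk ℂ V 𝒜).flip 1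

@[simp] lemma coeff_tensor (δ : V →ₗ[ℂ] V ⊗[ℂ] 𝒜) (γ : W →ₗ[ℂ] W ⊗[ℂ] 𝒜) (x y : V) (x' y' : W) :
    coeff (tensorCoaction δ γ) (x ⊗ₜ x') (y ⊗ₜ y') = coeff δ x y * coeff γ x' y' := by
  have key : ∀ (s : V ⊗[ℂ] 𝒜) (t : W ⊗[ℂ] 𝒜),
      slice (x ⊗ₜ[ℂ] x') ((LinearMap.mul' ℂ 𝒜).lTensor (V ⊗[ℂ] W)
        (TensorProduct.tensorTensorTensorComm ℂ V 𝒜 W 𝒜 (s ⊗ₜ[ℂ] t))) =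
      slice x s * slice x' t := by
    intro s t
    induction s with
    | zero => simp
    | add s₁ s₂ h₁ h₂ => simp [TensorProduct.add_tmul, h₁, h₂, add_mul]
    | tmul v a =>
      induction t with
      | zero => simp
      | add t₁ t₂ h₁ h₂ => simp [TensorProduct.tmul_add, h₁, h₂, mul_add]
      | tmul w c => simp [smul_smul, mul_comm]
  simpa [coeff, tensorCoaction] using key (δ y) (γ y')

@[simp] lemma coeff_trivial (x y : V) :
    coeff (trivialCoaction (𝒜 := 𝒜) V) x y = ⟪x, y⟫_ℂ • (1 : 𝒜) := by
  simp [coeff, trivialCoaction]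

lemma isUnitaryCorep_trivial : IsUnitaryCorep (trivialCoaction (𝒜 := 𝒜) V) where
  coassoc := by
    ext v
    simp [trivialCoaction, Algebra.TensorProduct.one_def]
  counit := by
    ext v
    simp [trivialCoaction]
  unitary := by
    classical
    refine isUnitaryCoeff_of_basis _ (stdOrthonormalBasis ℂ V) ?_ ?_ <;> intro i k <;>
      simp only [coeff_trivial, OrthonormalBasis.inner_eq_ite] <;>
      rcases eq_or_ne i k with rfl | h <;> simp_all [eq_comm]

lemma isUnitaryCorep_tensor {δ : V →ₗ[ℂ] V ⊗[ℂ] 𝒜} {γ : W →ₗ[ℂ] W ⊗[ℂ] 𝒜}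
    (hδ : IsUnitaryCorep δ) (hγ : IsUnitaryCorep γ) : IsUnitaryCorep (tensorCoaction δ γ) where
  coassoc := by
    let v := stdOrthonormalBasis ℂ V
    let w := stdOrthonormalBasis ℂ W
    rw [coassoc_iff _ (v.tensorProduct w)]
    have h1 := (coassoc_iff δ v).1 hδ.coassoc
    have h2 := (coassoc_iff γ w).1 hγ.coassoc
    intro x y
    induction x with
    | zero => simp only [← coeffₛₗ_apply]; simp
    | add x₁ x₂ e₁ e₂ =>
      simp only [← coeffₛₗ_apply] at e₁ e₂ ⊢
      simp [e₁, e₂, TensorProduct.add_tmul, Finset.sum_add_distrib]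
    | tmul x x' =>
      induction y with
      | zero => simp only [← coeffₛₗ_apply]; simp
      | add x₁ x₂ e₁ e₂ =>
        simp only [← coeffₛₗ_apply] at e₁ e₂ ⊢
        simp [e₁, e₂, TensorProduct.tmul_add, Finset.sum_add_distrib]
      | tmul y y' =>
        simp only [coeff_tensor, Bialgebra.comul_mul, h1, h2, Finset.sum_mul_sum,
          Algebra.TensorProduct.tmul_mul_tmul, Fintype.sum_prod_type,
          OrthonormalBasis.tensorProduct_apply]
  counit := by
    rw [counit_iff]
    have h1 := (counit_iff δ).1 hδ.counit
    have h2 := (counit_iff γ).1 hγ.counit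
    intro x y
    induction x with
    | zero => simp only [← coeffₛₗ_apply]; simp
    | add x₁ x₂ e₁ e₂ =>
      simp only [← coeffₛₗ_apply] at e₁ e₂ ⊢
      simp [e₁, e₂]
    | tmul x x' =>
      induction y with
      | zero => simp only [← coeffₛₗ_apply]; simp
      | add x₁ x₂ e₁ e₂ =>
        simp only [← coeffₛₗ_apply] at e₁ e₂ ⊢
        simp [e₁, e₂]
      | tmul y y' => simp [h1, h2]
  unitary := by
    classical
    let v := stdOrthonormalBasis ℂ V
    let w := stdOrthonormalBasis ℂ W
    refine isUnitaryCoeff_of_basis _ (v.tensorProduct w) ?_ ?_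
    · rintro ⟨i, i'⟩ ⟨k, k'⟩
      have e : ∀ j', ∑ j, star (coeff δ (v j) (v i) * coeff γ (w j') (w i')) *
          (coeff δ (v j) (v k) * coeff γ (w j') (w k')) =
          ⟪v i, v k⟫_ℂ • (star (coeff γ (w j') (w i')) * coeff γ (w j') (w k')) := by
        intro j'
        have : ∀ j, star (coeff δ (v j) (v i) * coeff γ (w j') (w i')) *
            (coeff δ (v j) (v k) * coeff γ (w j') (w k')) = star (coeff γ (w j') (w i')) *
            (star (coeff δ (v j) (v i)) * coeff δ (v j) (v k)) * coeff γ (w j') (w k') := by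
          intro j; simp only [StarMul.star_mul, mul_assoc]
        simp only [this, ← Finset.sum_mul, ← Finset.mul_sum, hδ.unitary.star_mul v]
        simp
      simp only [OrthonormalBasis.tensorProduct_apply, coeff_tensor, Fintype.sum_prod_type_right,
        e, ← Finset.smul_sum, hγ.unitary.star_mul w, OrthonormalBasis.inner_eq_ite, Prod.mk.injEq]
      split_ifs <;> simp_all
    · rintro ⟨i, i'⟩ ⟨k, k'⟩
      have e : ∀ j, ∑ j', (coeff δ (v i) (v j) * coeff γ (w i') (w j')) *
          star (coeff δ (v k) (v j) * coeff γ (w k') (w j')) =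
          ⟪w i', w k'⟫_ℂ • (coeff δ (v i) (v j) * star (coeff δ (v k) (v j))) := by
        intro j
        have : ∀ j', (coeff δ (v i) (v j) * coeff γ (w i') (w j')) *
            star (coeff δ (v k) (v j) * coeff γ (w k') (w j')) = coeff δ (v i) (v j) *
            (coeff γ (w i') (w j') * star (coeff γ (w k') (w j'))) * star (coeff δ (v k) (v j)) := by
          intro j'; simp only [StarMul.star_mul, mul_assoc]
        simp only [this, ← Finset.sum_mul, ← Finset.mul_sum, hγ.unitary.mul_star w]
        simp
      simp only [OrthonormalBasis.tensorProduct_apply, coeff_tensor, Fintype.sum_prod_type,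
        e, ← Finset.smul_sum, hδ.unitary.mul_star v, OrthonormalBasis.inner_eq_ite, Prod.mk.injEq]
      split_ifs <;> simp_all

lemma intertwiner_of_isometry {δ : V →ₗ[ℂ] V ⊗[ℂ] 𝒜} {γ : W →ₗ[ℂ] W ⊗[ℂ] 𝒜} (e : V ≃ₗᵢ[ℂ] W)
    (h : ∀ x y, coeff γ (e x) (e y) = coeff δ x y) :
    γ ∘ₗ (e.toLinearEquiv : V →ₗ[ℂ] W) = (e.toLinearEquiv : V →ₗ[ℂ] W).rTensor 𝒜 ∘ₗ δ := by
  rw [intertwiner_iff]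
  intro x y
  obtain ⟨x, rfl⟩ := e.surjective x
  have : LinearMap.adjoint (e.toLinearEquiv : V →ₗ[ℂ] W) (e x) = x := by
    refine ext_inner_right ℂ fun z => ?_
    rw [LinearMap.adjoint_inner_left]
    exact e.inner_map_map x z
  rw [this]
  exact h x y

lemma intertwiner_symm {δ : V →ₗ[ℂ] V ⊗[ℂ] 𝒜} {γ : W →ₗ[ℂ] W ⊗[ℂ] 𝒜} (e : V ≃ₗ[ℂ] W)
    (h : γ ∘ₗ (e : V →ₗ[ℂ] W) = (e : V →ₗ[ℂ] W).rTensor 𝒜 ∘ₗ δ) :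
    δ ∘ₗ (e.symm : W →ₗ[ℂ] V) = (e.symm : W →ₗ[ℂ] V).rTensor 𝒜 ∘ₗ γ := by
  ext y
  obtain ⟨x, rfl⟩ := e.surjective y
  have := LinearMap.congr_fun h x
  simp only [LinearMap.comp_apply, LinearEquiv.coe_coe] at this
  simp only [LinearMap.comp_apply, LinearEquiv.coe_coe, LinearEquiv.symm_apply_apply, this]
  rw [← LinearMap.comp_apply, ← LinearMap.rTensor_comp]
  simp

lemma intertwiner_tensor {V' W' : Type} [NormedAddCommGroup V'] [InnerProductSpace ℂ V']
    [NormedAddCommGroup W'] [InnerProductSpace ℂ W'] [FiniteDimensional ℂ V']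
    [FiniteDimensional ℂ W'] {δ : V →ₗ[ℂ] V ⊗[ℂ] 𝒜} {γ : W →ₗ[ℂ] W ⊗[ℂ] 𝒜}
    {δ' : V' →ₗ[ℂ] V' ⊗[ℂ] 𝒜} {γ' : W' →ₗ[ℂ] W' ⊗[ℂ] 𝒜} {f : V →ₗ[ℂ] V'} {g : W →ₗ[ℂ] W'}
    (hf : δ' ∘ₗ f = f.rTensor 𝒜 ∘ₗ δ) (hg : γ' ∘ₗ g = g.rTensor 𝒜 ∘ₗ γ) :
    tensorCoaction δ' γ' ∘ₗ TensorProduct.map f g =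
      (TensorProduct.map f g).rTensor 𝒜 ∘ₗ tensorCoaction δ γ := by
  rw [intertwiner_iff] at *
  intro x y
  induction x with
  | zero => simp only [← coeffₛₗ_apply]; simp
  | add x₁ x₂ e₁ e₂ =>
    simp only [← coeffₛₗ_apply] at e₁ e₂ ⊢
    simp only [map_add, LinearMap.add_apply, e₁, e₂]
  | tmul x x' =>
    induction y with
    | zero => simp only [← coeffₛₗ_apply]; simp
    | add x₁ x₂ e₁ e₂ =>
      simp only [← coeffₛₗ_apply] at e₁ e₂ ⊢
      simp only [map_add, e₁, e₂]
    | tmul y y' => simp [hf, hg]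

end Coeff

end Corep

/-! ### The category of finite-dimensional unitary corepresentations -/

section CorepCategory

set_option linter.unusedSectionVars false

variable (𝒜 : Type u) [Ring 𝒜] [StarRing 𝒜] [HopfAlgebra ℂ 𝒜] [StarModule ℂ 𝒜]

/-- A Hopf `*`-algebra (the comultiplication is a `*`-homomorphism) is a compact quantum group
algebra if it is generated as an algebra by the matrix coefficients of its finite-dimensional
unitary corepresentations. -/
class CompactQuantumGroupAlgebra : Prop where
  comul_star : ∀ a : 𝒜, Coalgebra.comul (R := ℂ) (star a) = star (Coalgebra.comul (R := ℂ) a)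
  generated : Algebra.adjoin ℂ {a : 𝒜 | ∃ (V : FHilb) (δ : V →ₗ[ℂ] V ⊗[ℂ] 𝒜) (x y : V),
    IsUnitaryCorep δ ∧ a = coeff δ x y} = ⊤

/-- Finite-dimensional unitary corepresentations of `𝒜`, that is, finite-dimensional unitary
representations of the compact quantum group with algebra `𝒜`. -/
structure Corep where
  space : FHilb
  coaction : space →ₗ[ℂ] space ⊗[ℂ] 𝒜
  isUnitary : IsUnitaryCorep coaction

variable {𝒜}

namespace Corep

/-- Morphisms of corepresentations are intertwiners. -/
@[ext] structure Hom (X Y : Corep 𝒜) where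
  hom : X.space ⟶ Y.space
  comm : Y.coaction ∘ₗ hom.lin = hom.lin.rTensor 𝒜 ∘ₗ X.coaction

instance : Category (Corep 𝒜) where
  Hom X Y := Hom X Y
  id X := ⟨𝟙 X.space, by ext x; simp⟩
  comp {X Y Z} f g := ⟨f.hom ≫ g.hom, by
    rw [FHilb.comp_lin, ← LinearMap.comp_assoc, g.comm, LinearMap.comp_assoc, f.comm,
      LinearMap.rTensor_comp, LinearMap.comp_assoc]⟩

@[ext] lemma hom_ext {X Y : Corep 𝒜} {f g : X ⟶ Y} (h : f.hom = g.hom) : f = g := Hom.ext h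

@[simp] lemma id_hom (X : Corep 𝒜) : Hom.hom (𝟙 X) = 𝟙 X.space := rfl

@[simp] lemma comp_hom {X Y Z : Corep 𝒜} (f : X ⟶ Y) (g : Y ⟶ Z) :
    (f ≫ g).hom = f.hom ≫ g.hom := rfl

lemma hom_injective (X Y : Corep 𝒜) : Function.Injective (fun f : X ⟶ Y => f.hom) :=
  fun _ _ h => hom_ext h

instance (X Y : Corep 𝒜) : Zero (X ⟶ Y) := ⟨⟨0, by simp⟩⟩
instance (X Y : Corep 𝒜) : Add (X ⟶ Y) := ⟨fun f g => ⟨f.hom + g.hom, by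
  rw [FHilb.add_lin, LinearMap.comp_add, f.comm, g.comm, LinearMap.rTensor_add,
    LinearMap.add_comp]⟩⟩
instance (X Y : Corep 𝒜) : SMul ℂ (X ⟶ Y) := ⟨fun c f => ⟨c • f.hom, by
  rw [FHilb.smul_lin, LinearMap.comp_smul, f.comm, LinearMap.rTensor_smul,
    LinearMap.smul_comp]⟩⟩
instance (X Y : Corep 𝒜) : Neg (X ⟶ Y) := ⟨fun f => ⟨-f.hom, by
  change Y.coaction ∘ₗ (-f.hom.lin) = (-f.hom.lin).rTensor 𝒜 ∘ₗ X.coaction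
  rw [LinearMap.comp_neg, f.comm, LinearMap.rTensor_neg, LinearMap.neg_comp]⟩⟩
instance (X Y : Corep 𝒜) : Sub (X ⟶ Y) := ⟨fun f g => ⟨f.hom - g.hom, by
  change Y.coaction ∘ₗ (f.hom.lin - g.hom.lin) = (f.hom.lin - g.hom.lin).rTensor 𝒜 ∘ₗ X.coaction
  rw [LinearMap.comp_sub, f.comm, g.comm, LinearMap.rTensor_sub, LinearMap.sub_comp]⟩⟩
instance (X Y : Corep 𝒜) : SMul ℕ (X ⟶ Y) := ⟨fun n f => ⟨n • f.hom, by
  change Y.coaction ∘ₗ (n • f.hom.lin) = (n • f.hom.lin).rTensor 𝒜 ∘ₗ X.coaction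
  rw [← Nat.cast_smul_eq_nsmul ℂ, LinearMap.comp_smul, f.comm, LinearMap.rTensor_smul,
    LinearMap.smul_comp]⟩⟩
instance (X Y : Corep 𝒜) : SMul ℤ (X ⟶ Y) := ⟨fun n f => ⟨n • f.hom, by
  change Y.coaction ∘ₗ (n • f.hom.lin) = (n • f.hom.lin).rTensor 𝒜 ∘ₗ X.coaction
  rw [← Int.cast_smul_eq_zsmul ℂ, LinearMap.comp_smul, f.comm, LinearMap.rTensor_smul,
    LinearMap.smul_comp]⟩⟩

instance (X Y : Corep 𝒜) : AddCommGroup (X ⟶ Y) :=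
  (hom_injective X Y).addCommGroup _ rfl (fun _ _ => rfl) (fun _ => rfl) (fun _ _ => rfl)
    (fun _ _ => rfl) (fun _ _ => rfl)

@[simp] lemma add_hom {X Y : Corep 𝒜} (f g : X ⟶ Y) : Hom.hom (f + g) = f.hom + g.hom := rfl
@[simp] lemma smul_hom {X Y : Corep 𝒜} (c : ℂ) (f : X ⟶ Y) : Hom.hom (c • f) = c • f.hom := rfl

instance : Preadditive (Corep 𝒜) where
  add_comp := by intros; apply hom_ext; simp
  comp_add := by intros; apply hom_ext; simp

instance (X Y : Corep 𝒜) : Module ℂ (X ⟶ Y) :=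
  Function.Injective.module ℂ ⟨⟨fun f : X ⟶ Y => f.hom, rfl⟩, fun _ _ => rfl⟩
    (hom_injective X Y) (fun _ _ => rfl)

instance : Linear ℂ (Corep 𝒜) where
  smul_comp := by intros; apply hom_ext; simp
  comp_smul := by intros; apply hom_ext; simp

/-- The dagger of an intertwiner is its Hermitian adjoint. -/
instance : DaggerCategory (Corep 𝒜) where
  dagger {X Y} f := ⟨dag f.hom, intertwiner_adjoint X.isUnitary.unitary Y.isUnitary.unitary f.comm⟩
  dagger_id _ := hom_ext (DaggerCategory.dagger_id _)
  dagger_comp _ _ := hom_ext (DaggerCategory.dagger_comp _ _)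
  dagger_dagger _ := hom_ext (DaggerCategory.dagger_dagger _)

@[simp] lemma dag_hom {X Y : Corep 𝒜} (f : X ⟶ Y) : (dag f).hom = dag f.hom := rfl

/-- An invertible intertwiner as an isomorphism. -/
def isoOfEquiv {X Y : Corep 𝒜} (e : X.space ≃ₗ[ℂ] Y.space)
    (h : Y.coaction ∘ₗ (e : X.space →ₗ[ℂ] Y.space) =
      (e : X.space →ₗ[ℂ] Y.space).rTensor 𝒜 ∘ₗ X.coaction) : X ≅ Y where
  hom := ⟨⟨e⟩, h⟩
  inv := ⟨⟨e.symm⟩, intertwiner_symm e h⟩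
  hom_inv_id := by ext x; simp
  inv_hom_id := by ext x; simp

/-- The tensor product of corepresentations. -/
def tensorObj (X Y : Corep 𝒜) : Corep 𝒜 where
  space := ⟨X.space ⊗[ℂ] Y.space⟩
  coaction := tensorCoaction X.coaction Y.coaction
  isUnitary := isUnitaryCorep_tensor X.isUnitary Y.isUnitary

/-- The trivial corepresentation on `ℂ`. -/
def unitObj : Corep 𝒜 where
  space := ⟨ℂ⟩
  coaction := trivialCoaction ℂ
  isUnitary := isUnitaryCorep_trivial

lemma coeff_tensor_ext {V W U : Type} [NormedAddCommGroup V] [InnerProductSpace ℂ V]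
    [NormedAddCommGroup W] [InnerProductSpace ℂ W] [NormedAddCommGroup U] [InnerProductSpace ℂ U]
    {δ : V ⊗[ℂ] W →ₗ[ℂ] (V ⊗[ℂ] W) ⊗[ℂ] 𝒜} {γ : U →ₗ[ℂ] U ⊗[ℂ] 𝒜} (f : V ⊗[ℂ] W →ₗ[ℂ] U)
    (h : ∀ v w v' w', coeff γ (f (v ⊗ₜ w)) (f (v' ⊗ₜ w')) = coeff δ (v ⊗ₜ w) (v' ⊗ₜ w')) :
    ∀ x y, coeff γ (f x) (f y) = coeff δ x y := by
  intro x y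
  induction x with
  | zero => simp only [← coeffₛₗ_apply]; simp
  | add x₁ x₂ e₁ e₂ =>
    simp only [← coeffₛₗ_apply] at e₁ e₂ ⊢
    simp only [map_add, LinearMap.add_apply, e₁, e₂]
  | tmul x x' =>
    induction y with
    | zero => simp only [← coeffₛₗ_apply]; simp
    | add x₁ x₂ e₁ e₂ =>
      simp only [← coeffₛₗ_apply] at e₁ e₂ ⊢
      simp only [map_add, e₁, e₂]
    | tmul y y' => exact h x x' y y'

lemma coeff_assoc {V W U : Type} [NormedAddCommGroup V] [InnerProductSpace ℂ V]
    [NormedAddCommGroup W] [InnerProductSpace ℂ W] [NormedAddCommGroup U] [InnerProductSpace ℂ U]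
    [FiniteDimensional ℂ V] [FiniteDimensional ℂ W] [FiniteDimensional ℂ U]
    (δ : V →ₗ[ℂ] V ⊗[ℂ] 𝒜) (γ : W →ₗ[ℂ] W ⊗[ℂ] 𝒜) (κ : U →ₗ[ℂ] U ⊗[ℂ] 𝒜)
    (p q : V ⊗[ℂ] W) (w w' : U) :
    coeff (tensorCoaction δ (tensorCoaction γ κ)) (TensorProduct.assoc ℂ V W U (p ⊗ₜ w))
      (TensorProduct.assoc ℂ V W U (q ⊗ₜ w')) =
    coeff (tensorCoaction δ γ) p q * coeff κ w w' := by
  induction p with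
  | zero =>
    rw [TensorProduct.zero_tmul, map_zero]
    simp only [← coeffₛₗ_apply, map_zero, LinearMap.zero_apply, zero_mul]
  | add x₁ x₂ e₁ e₂ =>
    rw [TensorProduct.add_tmul, map_add]
    simp only [← coeffₛₗ_apply] at e₁ e₂ ⊢
    rw [map_add, map_add, LinearMap.add_apply, LinearMap.add_apply, add_mul, e₁, e₂]
  | tmul x x' =>
    induction q with
    | zero =>
      rw [TensorProduct.zero_tmul, map_zero]
      simp only [← coeffₛₗ_apply, map_zero, zero_mul]
    | add x₁ x₂ e₁ e₂ =>
      rw [TensorProduct.add_tmul, map_add]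
      simp only [← coeffₛₗ_apply] at e₁ e₂ ⊢
      rw [map_add, map_add, add_mul, e₁, e₂]
    | tmul y y' =>
      rw [TensorProduct.assoc_tmul, TensorProduct.assoc_tmul, coeff_tensor, coeff_tensor,
        coeff_tensor, mul_assoc]

lemma assoc_comm {V W U : Type} [NormedAddCommGroup V] [InnerProductSpace ℂ V]
    [NormedAddCommGroup W] [InnerProductSpace ℂ W] [NormedAddCommGroup U] [InnerProductSpace ℂ U]
    [FiniteDimensional ℂ V] [FiniteDimensional ℂ W] [FiniteDimensional ℂ U]
    (δ : V →ₗ[ℂ] V ⊗[ℂ] 𝒜) (γ : W →ₗ[ℂ] W ⊗[ℂ] 𝒜) (κ : U →ₗ[ℂ] U ⊗[ℂ] 𝒜) :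
    tensorCoaction δ (tensorCoaction γ κ) ∘ₗ (TensorProduct.assoc ℂ V W U).toLinearMap =
    (TensorProduct.assoc ℂ V W U).toLinearMap.rTensor 𝒜 ∘ₗ
      tensorCoaction (tensorCoaction δ γ) κ := by
  have h := coeff_tensor_ext (δ := tensorCoaction (tensorCoaction δ γ) κ)
    (γ := tensorCoaction δ (tensorCoaction γ κ)) (TensorProduct.assoc ℂ V W U).toLinearMap
    (fun p w q w' => (coeff_assoc δ γ κ p q w w').trans (coeff_tensor _ _ _ _ _ _).symm)
  exact intertwiner_of_isometry (TensorProduct.assocIsometry ℂ V W U) h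

lemma lid_comm (X : Corep 𝒜) :
    X.coaction ∘ₗ (TensorProduct.lid ℂ X.space).toLinearMap =
    (TensorProduct.lid ℂ X.space).toLinearMap.rTensor 𝒜 ∘ₗ
      tensorCoaction (trivialCoaction ℂ) X.coaction := by
  refine intertwiner_of_isometry (TensorProduct.lidIsometry ℂ X.space) ?_
  refine coeff_tensor_ext (TensorProduct.lid ℂ X.space).toLinearMap ?_
  intro v w v' w'
  simp only [coeff_tensor, coeff_trivial, LinearEquiv.coe_coe, TensorProduct.lid_tmul]
  simp only [← coeffₛₗ_apply]
  simp [smul_smul]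

lemma rid_comm (X : Corep 𝒜) :
    X.coaction ∘ₗ (TensorProduct.rid ℂ X.space).toLinearMap =
    (TensorProduct.rid ℂ X.space).toLinearMap.rTensor 𝒜 ∘ₗ
      tensorCoaction X.coaction (trivialCoaction ℂ) := by
  refine intertwiner_of_isometry (TensorProduct.ridIsometry ℂ X.space) ?_
  refine coeff_tensor_ext (TensorProduct.rid ℂ X.space).toLinearMap ?_
  intro v w v' w'
  simp only [coeff_tensor, coeff_trivial, LinearEquiv.coe_coe, TensorProduct.rid_tmul]
  simp only [← coeffₛₗ_apply]
  simp [smul_smul]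

instance : MonoidalCategoryStruct (Corep 𝒜) where
  tensorObj := tensorObj
  whiskerLeft X _ _ f := ⟨X.space ◁ f.hom,
    intertwiner_tensor (f := LinearMap.id) (by ext; simp) f.comm⟩
  whiskerRight f X := ⟨f.hom ▷ X.space,
    intertwiner_tensor (g := LinearMap.id) f.comm (by ext; simp)⟩
  tensorHom f g := ⟨f.hom ⊗ₘ g.hom, intertwiner_tensor f.comm g.comm⟩
  tensorUnit := unitObj
  associator X Y Z := isoOfEquiv (X := tensorObj (tensorObj X Y) Z) (Y := tensorObj X (tensorObj Y Z))
    (TensorProduct.assoc ℂ X.space Y.space Z.space) (assoc_comm X.coaction Y.coaction Z.coaction)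
  leftUnitor X := isoOfEquiv (X := tensorObj unitObj X) (TensorProduct.lid ℂ X.space) (lid_comm X)
  rightUnitor X := isoOfEquiv (X := tensorObj X unitObj) (TensorProduct.rid ℂ X.space) (rid_comm X)

variable (𝒜) in
/-- The forgetful functor: a corepresentation to its underlying Hilbert space, an intertwiner to
its underlying linear map. -/
@[simps] def forget : Corep 𝒜 ⥤ FHilb where
  obj X := X.space
  map f := f.hom

instance : (forget 𝒜).Faithful := ⟨fun h => hom_ext h⟩
instance : (forget 𝒜).Additive := ⟨rfl⟩
instance : (forget 𝒜).Linear ℂ := ⟨fun _ _ => rfl⟩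

instance : MonoidalCategory (Corep 𝒜) where
  tensorHom_def _ _ := hom_ext (tensorHom_def (C := FHilb) _ _)
  id_tensorHom_id _ _ := hom_ext (id_tensorHom_id (C := FHilb) _ _)
  tensorHom_comp_tensorHom _ _ _ _ := hom_ext (tensorHom_comp_tensorHom (C := FHilb) _ _ _ _)
  whiskerLeft_id _ _ := hom_ext (whiskerLeft_id (C := FHilb) _ _)
  id_whiskerRight _ _ := hom_ext (id_whiskerRight (C := FHilb) _ _)
  associator_naturality _ _ _ := hom_ext (associator_naturality (C := FHilb) _ _ _)
  leftUnitor_naturality _ := hom_ext (leftUnitor_naturality (C := FHilb) _)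
  rightUnitor_naturality _ := hom_ext (rightUnitor_naturality (C := FHilb) _)
  pentagon _ _ _ _ := hom_ext (pentagon (C := FHilb) _ _ _ _)
  triangle _ _ := hom_ext (triangle (C := FHilb) _ _)

/-- The forgetful functor is strictly monoidal. -/
instance : (forget 𝒜).Monoidal :=
  Functor.CoreMonoidal.toMonoidal
    { εIso := Iso.refl (𝟙_ FHilb)
      μIso := fun X Y => Iso.refl (X.space ⊗ Y.space : FHilb)
      μIso_hom_natural_left := fun _ _ => rfl
      μIso_hom_natural_right := fun _ _ => rfl
      associativity := fun _ _ _ => FHilb.hom_ext (TensorProduct.ext_threefold fun _ _ _ => rfl)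
      left_unitality := fun _ => FHilb.hom_ext (TensorProduct.ext' fun _ _ => rfl)
      right_unitality := fun _ => FHilb.hom_ext (TensorProduct.ext' fun _ _ => rfl) }

end Corep

end CorepCategory

/-! ### Frobenius algebras in a monoidal dagger category -/

section Frobenius

variable {C : Type u} [Category.{v} C] [MonoidalCategory C] [DaggerCategory C]

/-- The multiplication of an algebra `[A, m, u]`. -/
abbrev mul (A : Mon C) : A.X ⊗ A.X ⟶ A.X := MonObj.mul (X := A.X)

/-- The unit of an algebra `[A, m, u]`. -/
abbrev one (A : Mon C) : 𝟙_ C ⟶ A.X := MonObj.one (X := A.X)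

/-- The comultiplication `m†`. -/
abbrev comul (A : Mon C) : A.X ⟶ A.X ⊗ A.X := dag (mul A)

/-- The counit `u†`. -/
abbrev counit (A : Mon C) : A.X ⟶ 𝟙_ C := dag (one A)

/-- The Frobenius equation `(m ⊗ id)(id ⊗ m†) = m† m = (id ⊗ m)(m† ⊗ id)`. -/
def IsFrobenius (A : Mon C) : Prop :=
  A.X ◁ comul A ≫ (α_ A.X A.X A.X).inv ≫ mul A ▷ A.X = mul A ≫ comul A ∧
  comul A ▷ A.X ≫ (α_ A.X A.X A.X).hom ≫ A.X ◁ mul A = mul A ≫ comul A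

/-- Speciality, `m m† = id`. -/
def IsSpecial (A : Mon C) : Prop := comul A ≫ mul A = 𝟙 A.X

/-- The cup `m† u` of the canonical self-duality of a Frobenius algebra. -/
def frobCup (A : Mon C) : 𝟙_ C ⟶ A.X ⊗ A.X := one A ≫ comul A

/-- The cap `u† m` of the canonical self-duality of a Frobenius algebra. -/
def frobCap (A : Mon C) : A.X ⊗ A.X ⟶ 𝟙_ C := mul A ≫ counit A

/-- Standardness: the two traces on `End A` defined by the canonical self-duality agree. -/
def IsStandard (A : Mon C) : Prop :=
  ∀ f : A.X ⟶ A.X, frobCup A ≫ f ▷ A.X ≫ frobCap A = frobCup A ≫ A.X ◁ f ≫ frobCap A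

/-- Special Frobenius algebras. -/
structure IsSpecialFrobenius (A : Mon C) : Prop where
  frobenius : IsFrobenius A
  special : IsSpecial A

/-- Standard special Frobenius algebras. -/
structure IsSSFA (A : Mon C) : Prop extends IsSpecialFrobenius A where
  standard : IsStandard A

/-- A `*`-cohomomorphism preserves the comultiplication, the counit and the involution. The last
condition is `f† = (id ⊗ cap) (id ⊗ f ⊗ id) (cup ⊗ id)`; for Frobenius algebras of Hilbert spaces,
where the involution is `x* = (⟨x| ⊗ id) (cup)`, this says `f (x*) = (f x)*`. -/
structure IsStarCohom (A B : Mon C) (f : A.X ⟶ B.X) : Prop where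
  comul : f ≫ comul B = comul A ≫ (f ⊗ₘ f)
  counit : f ≫ counit B = counit A
  star : dag f = (λ_ B.X).inv ≫ frobCup A ▷ B.X ≫ (α_ A.X A.X B.X).hom ≫
    A.X ◁ (f ▷ B.X ≫ frobCap B) ≫ (ρ_ A.X).hom

/-- The CP condition: `(id ⊗ m) (id ⊗ f ⊗ id) (m† ⊗ id) = g† g` for some `g : A ⊗ B ⟶ X`. -/
def IsCP (A B : Mon C) (f : A.X ⟶ B.X) : Prop :=
  ∃ (X : C) (g : A.X ⊗ B.X ⟶ X),
    EntSymm.comul A ▷ B.X ≫ (α_ A.X A.X B.X).hom ≫ A.X ◁ (f ▷ B.X ≫ mul B) = g ≫ dag g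

/-- A channel is a CP morphism which preserves the counit. -/
structure IsChannel (A B : Mon C) (f : A.X ⟶ B.X) : Prop where
  cp : IsCP A B f
  counit : f ≫ EntSymm.counit B = EntSymm.counit A

end Frobenius

/-! ### Fibre functors and unitary pseudonatural transformations -/

section FibreFunctor

open Functor.LaxMonoidal

variable (C : Type u) [Category.{v} C] [MonoidalCategory C] [DaggerCategory C]
  [Preadditive C] [Linear ℂ C]

/-- A fibre functor: a faithful unitary `ℂ`-linear (strong) monoidal functor to finite-dimensional
Hilbert spaces. -/
structure FibreFunctor where
  functor : C ⥤ FHilb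
  [monoidal : functor.Monoidal]
  [faithful : functor.Faithful]
  [additive : functor.Additive]
  [linear : functor.Linear ℂ]
  map_dag : ∀ {X Y : C} (f : X ⟶ Y), functor.map (dag f) = dag (functor.map f)
  unitary_μ : ∀ X Y : C, IsUnitary (μ functor X Y)
  unitary_ε : IsUnitary (ε functor)

attribute [instance] FibreFunctor.monoidal

variable {C}

/-- The image `[F(A), F(m) ∘ μ, F(u) ∘ ε]` of an algebra. -/
def FibreFunctor.mapAlg (F : FibreFunctor C) (A : Mon C) : Mon FHilb := F.functor.mapMon.obj A

/-- A unitary pseudonatural transformation `(α, H) : F₁ ⟶ F₂`. -/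
structure UPT (F₁ F₂ : FibreFunctor C) where
  H : FHilb
  app : ∀ X : C, F₁.functor.obj X ⊗ H ⟶ H ⊗ F₂.functor.obj X
  unitary : ∀ X : C, IsUnitary (app X)
  naturality : ∀ {X Y : C} (f : X ⟶ Y),
    F₁.functor.map f ▷ H ≫ app Y = app X ≫ H ◁ F₂.functor.map f
  app_tensor : ∀ X Y : C,
    μ F₁.functor X Y ▷ H ≫ app (X ⊗ Y) =
      (α_ (F₁.functor.obj X) (F₁.functor.obj Y) H).hom ≫
      F₁.functor.obj X ◁ app Y ≫
      (α_ (F₁.functor.obj X) H (F₂.functor.obj Y)).inv ≫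
      app X ▷ F₂.functor.obj Y ≫
      (α_ H (F₂.functor.obj X) (F₂.functor.obj Y)).hom ≫
      H ◁ μ F₂.functor X Y
  app_unit : ε F₁.functor ▷ H ≫ app (𝟙_ C) = (λ_ H).hom ≫ (ρ_ H).inv ≫ H ◁ ε F₂.functor

end FibreFunctor

/-- The canonical fibre functor of a compact quantum group. -/
def canonicalFibreFunctor (𝒜 : Type u) [Ring 𝒜] [StarRing 𝒜] [HopfAlgebra ℂ 𝒜]
    [StarModule ℂ 𝒜] : FibreFunctor (Corep 𝒜) where
  functor := Corep.forget 𝒜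
  map_dag _ := rfl
  unitary_μ X Y := ⟨by
    change 𝟙 (X.space ⊗ Y.space) ≫ dag (𝟙 (X.space ⊗ Y.space)) = 𝟙 (X.space ⊗ Y.space)
    simp [dag, DaggerCategory.dagger_id], by
    change dag (𝟙 (X.space ⊗ Y.space)) ≫ 𝟙 (X.space ⊗ Y.space) = 𝟙 (X.space ⊗ Y.space)
    simp [dag, DaggerCategory.dagger_id]⟩
  unitary_ε := ⟨by
    change 𝟙 (𝟙_ FHilb) ≫ dag (𝟙 (𝟙_ FHilb)) = 𝟙 (𝟙_ FHilb)
    simp [dag, DaggerCategory.dagger_id], by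
    change dag (𝟙 (𝟙_ FHilb)) ≫ 𝟙 (𝟙_ FHilb) = 𝟙 (𝟙_ FHilb)
    simp [dag, DaggerCategory.dagger_id]⟩

/-! ### The algebra `B(H)` and the maximally entangled state -/

section BH

variable {ι : Type*} [Fintype ι] {H : FHilb} (b : OrthonormalBasis ι ℂ H)

/-- The cup `1 ↦ ∑ i, |i⟩ ⊗ |i⟩` of the self-duality given by an orthonormal basis. -/
def cup : 𝟙_ FHilb ⟶ H ⊗ H := ⟨LinearMap.toSpanSingleton ℂ (H ⊗[ℂ] H) (∑ i, b i ⊗ₜ[ℂ] b i)⟩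

/-- The cap `|i⟩ ⊗ |j⟩ ↦ δᵢⱼ` of the self-duality given by an orthonormal basis. -/
def cap : H ⊗ H ⟶ 𝟙_ FHilb :=
  ⟨∑ i, LinearMap.mul' ℂ ℂ ∘ₗ TensorProduct.map (innerₛₗ ℂ (b i)) (innerₛₗ ℂ (b i))⟩

/-- `d = dim H`. -/
abbrev dimension (_ : OrthonormalBasis ι ℂ H) : ℝ := Fintype.card ι

/-- The multiplication `d^(-1/2) (id ⊗ cap ⊗ id)` on `H ⊗ H`. -/
def bhMul : (H ⊗ H) ⊗ (H ⊗ H) ⟶ H ⊗ H :=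
  ((1 / √(dimension b) : ℝ) : ℂ) • ((α_ H H (H ⊗ H)).hom ≫
    H ◁ ((α_ H H H).inv ≫ cap b ▷ H ≫ (λ_ H).hom))

/-- The unit `d^(1/2) cup` on `H ⊗ H`. -/
def bhOne : 𝟙_ FHilb ⟶ H ⊗ H := (√(dimension b) : ℂ) • cup b

lemma cap_tmul (x y : H) :
    (cap b).lin (x ⊗ₜ[ℂ] y) = ∑ i, ⟪b i, x⟫_ℂ * ⟪b i, y⟫_ℂ :=
  LinearMap.sum_apply _ _ _

lemma bhMul_tmul (x y z w : H) :
    (bhMul b).lin ((x ⊗ₜ[ℂ] y) ⊗ₜ[ℂ] (z ⊗ₜ[ℂ] w)) =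
      ((((1 / √(dimension b) : ℝ) : ℂ) * ∑ i, ⟪b i, y⟫_ℂ * ⟪b i, z⟫_ℂ) • x) ⊗ₜ[ℂ] w := by
  rw [← cap_tmul, mul_smul, ← TensorProduct.smul_tmul', TensorProduct.smul_tmul]
  rfl

lemma bhMul_assoc : bhMul b ▷ (H ⊗ H) ≫ bhMul b =
    (α_ (H ⊗ H) (H ⊗ H) (H ⊗ H)).hom ≫ (H ⊗ H) ◁ bhMul b ≫ bhMul b := by
  refine FHilb.hom_ext (TensorProduct.ext (TensorProduct.ext (TensorProduct.ext' fun x y =>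
    TensorProduct.ext' fun z w => TensorProduct.ext' fun u v => ?_)))
  change (bhMul b).lin ((bhMul b).lin ((x ⊗ₜ[ℂ] y) ⊗ₜ[ℂ] (z ⊗ₜ[ℂ] w)) ⊗ₜ[ℂ] (u ⊗ₜ[ℂ] v)) =
    (bhMul b).lin ((x ⊗ₜ[ℂ] y) ⊗ₜ[ℂ] (bhMul b).lin ((z ⊗ₜ[ℂ] w) ⊗ₜ[ℂ] (u ⊗ₜ[ℂ] v)))
  refine (congrArg (fun t => (bhMul b).lin (t ⊗ₜ[ℂ] (u ⊗ₜ[ℂ] v))) (bhMul_tmul b x y z w)).trans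
    ((bhMul_tmul b _ w u v).trans (Eq.symm ?_))
  refine (congrArg (fun t => (bhMul b).lin ((x ⊗ₜ[ℂ] y) ⊗ₜ[ℂ] t)) (bhMul_tmul b z w u v)).trans
    ((bhMul_tmul b x y _ v).trans ?_)
  rw [smul_smul]
  congr 2
  simp only [inner_smul_right, Finset.mul_sum, Finset.sum_mul]
  refine Finset.sum_congr rfl fun _ _ => Finset.sum_congr rfl fun _ _ => ?_
  ring

lemma sqrt_dim_mul [Nonempty ι] :
    ((1 / √(dimension b) : ℝ) : ℂ) * (√(dimension b) : ℂ) = 1 := by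
  have : (0 : ℝ) < √(dimension b) := Real.sqrt_pos.2 (Nat.cast_pos.2 Fintype.card_pos)
  rw [← Complex.ofReal_mul, one_div, inv_mul_cancel₀ this.ne', Complex.ofReal_one]

lemma bhOne_apply (c : ℂ) : (bhOne b).lin c =
    ∑ i, (((√(dimension b) : ℂ) * c) • b i) ⊗ₜ[ℂ] b i := by
  simp only [← TensorProduct.smul_tmul', ← Finset.smul_sum]
  rw [mul_smul]
  rfl

lemma bhOne_mul [Nonempty ι] : bhOne b ▷ (H ⊗ H) ≫ bhMul b = (λ_ (H ⊗ H)).hom := by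
  classical
  refine FHilb.hom_ext (TensorProduct.ext (LinearMap.ext fun (c : ℂ) => TensorProduct.ext' fun x y => ?_))
  change (bhMul b).lin ((bhOne b).lin c ⊗ₜ[ℂ] (x ⊗ₜ[ℂ] y)) = (c : ℂ) • (x ⊗ₜ[ℂ] y)
  refine (congrArg (fun t => (bhMul b).lin (t ⊗ₜ[ℂ] (x ⊗ₜ[ℂ] y))) (bhOne_apply b c)).trans ?_
  refine (congrArg (bhMul b).lin (TensorProduct.sum_tmul _ _ _)).trans ?_
  refine (map_sum (bhMul b).lin _ _).trans ?_
  refine (Finset.sum_congr rfl fun i _ => bhMul_tmul b _ _ _ _).trans ?_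
  refine (TensorProduct.sum_tmul _ _ _).symm.trans ?_
  rw [TensorProduct.smul_tmul']
  congr 1
  conv_rhs => rw [← b.sum_repr' x]
  rw [Finset.smul_sum]
  refine Finset.sum_congr rfl fun i _ => ?_
  rw [smul_smul, smul_smul]
  congr 1
  simp only [b.inner_eq_ite, ite_mul, one_mul, zero_mul, Finset.sum_ite_eq', Finset.mem_univ,
    if_true]
  linear_combination (⟪b i, x⟫_ℂ * c) * sqrt_dim_mul b

lemma bhMul_one [Nonempty ι] : (H ⊗ H) ◁ bhOne b ≫ bhMul b = (ρ_ (H ⊗ H)).hom := by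
  classical
  refine FHilb.hom_ext (TensorProduct.ext (TensorProduct.ext' fun x y => LinearMap.ext fun (c : ℂ) => ?_))
  change (bhMul b).lin ((x ⊗ₜ[ℂ] y) ⊗ₜ[ℂ] (bhOne b).lin c) = (c : ℂ) • (x ⊗ₜ[ℂ] y)
  refine (congrArg (fun t => (bhMul b).lin ((x ⊗ₜ[ℂ] y) ⊗ₜ[ℂ] t)) (bhOne_apply b c)).trans ?_
  refine (congrArg (bhMul b).lin (TensorProduct.tmul_sum _ _ _)).trans ?_
  refine (map_sum (bhMul b).lin _ _).trans ?_
  refine (Finset.sum_congr rfl fun i _ => bhMul_tmul b _ _ _ _).trans ?_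
  simp only [TensorProduct.smul_tmul]
  refine (TensorProduct.tmul_sum _ _ _).symm.trans ?_
  rw [← TensorProduct.tmul_smul]
  congr 1
  conv_rhs => rw [← b.sum_repr' y]
  rw [Finset.smul_sum]
  refine Finset.sum_congr rfl fun i _ => ?_
  rw [smul_smul]
  congr 1
  simp only [inner_smul_right, b.inner_eq_ite, mul_ite, mul_one, mul_zero, Finset.sum_ite_eq',
    Finset.mem_univ, if_true]
  linear_combination (⟪b i, y⟫_ℂ * c) * sqrt_dim_mul b

/-- The special Frobenius algebra `B(H)` on `H ⊗ H`. -/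
def bh [Nonempty ι] : Mon FHilb where
  X := H ⊗ H
  mon :=
    { one := bhOne b
      mul := bhMul b
      one_mul := bhOne_mul b
      mul_one := bhMul_one b
      mul_assoc := bhMul_assoc b }

/-- The channel `Ψ : ℂ ⟶ B(H) ⊗ B(H)` initialising the maximally entangled state. The density
operator `|ψ⟩⟨ψ| = d⁻¹ ∑ |i⟩⟨j| ⊗ |i⟩⟨j|` is normalised by the functional `d Tr` of each factor
`B(H)`, and the operator `|i⟩⟨j|` is the element `d^(1/2) |i⟩ ⊗ |j⟩` of `H ⊗ H`, so that
`Ψ(1) = d⁻² ∑ (|i⟩ ⊗ |j⟩) ⊗ (|i⟩ ⊗ |j⟩)`. -/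
def maxEntangled : 𝟙_ FHilb ⟶ (H ⊗ H) ⊗ (H ⊗ H) :=
  ⟨LinearMap.toSpanSingleton ℂ ((H ⊗[ℂ] H) ⊗[ℂ] (H ⊗[ℂ] H))
    (((1 / (dimension b) ^ 2 : ℝ) : ℂ) •
      ∑ i, ∑ j, (b i ⊗ₜ[ℂ] b j) ⊗ₜ[ℂ] (b i ⊗ₜ[ℂ] b j))⟩

/-- From `β : X ⊗ H ⟶ H ⊗ Y`, the map `d^(1/2) (cap ⊗ id) (id ⊗ β) (σ ⊗ id) : X ⊗ B(H) ⟶ Y`: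
the second leg of `B(H) = H ⊗ H` enters `β`, and the outgoing `H`-leg of `β` is contracted with
the first leg of `B(H)`, which is swapped past `X`. -/
def fromBH {X Y : FHilb} (β : X ⊗ H ⟶ H ⊗ Y) : X ⊗ (H ⊗ H) ⟶ Y :=
  (√(dimension b) : ℂ) • ((α_ X H H).inv ≫ (β_ X H).hom ▷ H ≫ (α_ H X H).hom ≫ H ◁ β ≫
    (α_ H H Y).inv ≫ cap b ▷ Y ≫ (λ_ Y).hom)

/-- From `β : X ⊗ H ⟶ H ⊗ Y`, the map `Y ⊗ H ⟶ H ⊗ X` obtained from `β†` by bending both `H`-legs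
with the cup and cap of `H`. -/
def bendDag {X Y : FHilb} (β : X ⊗ H ⟶ H ⊗ Y) : Y ⊗ H ⟶ H ⊗ X :=
  (λ_ (Y ⊗ H)).inv ≫ cup b ▷ (Y ⊗ H) ≫ (α_ H H (Y ⊗ H)).hom ≫
    H ◁ ((α_ H Y H).inv ≫ dag β ▷ H ≫ (α_ X H H).hom ≫ X ◁ cap b ≫ (ρ_ X).hom)

end BH

section Maps

variable {C : Type u} [Category.{v} C] [MonoidalCategory C] [DaggerCategory C]
  [Preadditive C] [Linear ℂ C] {F₁ F₂ : FibreFunctor C} (α : UPT F₁ F₂)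
  {ι : Type*} [Fintype ι] (b : OrthonormalBasis ι ℂ α.H)

/-- The components `α*_X : F₂(X) ⊗ H ⟶ H ⊗ F₁(X)` of the dual transformation. -/
def UPT.dualApp (X : C) : F₂.functor.obj X ⊗ α.H ⟶ α.H ⊗ F₁.functor.obj X :=
  bendDag b (α.app X)

/-- The map `u_A : F₁(A) ⊗ B(H) ⟶ F₂(A)`, built from `α`. -/
def UPT.u (A : Mon C) : F₁.functor.obj A.X ⊗ (α.H ⊗ α.H) ⟶ F₂.functor.obj A.X :=
  fromBH b (α.app A.X)

/-- The map `v_A : F₂(A) ⊗ B(H) ⟶ F₁(A)`, built from the dual of `α`. -/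
def UPT.v (A : Mon C) : F₂.functor.obj A.X ⊗ (α.H ⊗ α.H) ⟶ F₁.functor.obj A.X :=
  fromBH b (α.dualApp b A.X)

/-- `w ∘ (w' ⊗ id) ∘ (id ⊗ Ψ)`: the maps `w'` and `w` are composed along the two halves of a
maximally entangled state. -/
def entComp {H : FHilb} (b : OrthonormalBasis ι ℂ H) {X Y : FHilb} (w' : X ⊗ (H ⊗ H) ⟶ Y)
    (w : Y ⊗ (H ⊗ H) ⟶ X) : X ⟶ X :=
  (ρ_ X).inv ≫ X ◁ maxEntangled b ≫ (α_ X (H ⊗ H) (H ⊗ H)).inv ≫ w' ▷ (H ⊗ H) ≫ w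

end Maps

end EntSymm
end

open CategoryTheory MonoidalCategory TensorProduct
open scoped InnerProductSpace

noncomputable section

namespace EntSymm

universe u v

/-! ### Compatibility of the dagger of `FHilb` with the monoidal structure -/

/-! In an orthonormal basis of the space `H` of the transformation, its components become matrices
of operators a_ij, and every axiom becomes an identity between entries. Naturality says that each
a_ij commutes with the images of morphisms. Compatibility with tensor products says that a_ij on a
product is ∑_k a_ik ⊗ a_kj. Compatibility with units gives δ_ij, and unitarity gives ∑_i a_ij† a_ik
= δ_jk and ∑_k a_ik a_jk† = δ_ij. The maps u and v send x ⊗ (e_j ⊗ e_k) to √d a_jk x and √d a_jk† x.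

The comultiplication of `B(H)` is d^(-1/2) times the insertion of ∑_l e_l ⊗ e_l. So preservation of
the comultiplication by u is exactly the matrix-product rule (`UPT.comul_mat`,
`comp_comul_of_matrix`), and likewise for the counit. For v one takes adjoints of the rules for the
multiplication and the unit.

The involution is the subtle point. Let s and t be the cups m†u of the two images of A. The
comultiplication rule applied to the unit gives ∑_k (a_ik ⊗ a_kj) s = δ_ij t. Unitarity cancels one
factor and leaves (1 ⊗ a_lj) s = (a_jl† ⊗ 1) t, which is the involution condition for u
(`IsUnitaryMatrix.lTensor_eq_rTensor_adjoint`). For v the legs are exchanged: (a_jk ⊗ 1) s = (1 ⊗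
a_kj†) t. This holds because the sum over j, k of the squared distances expands, by the first
relation and unitarity, to d‖s‖² - 2d‖s‖² + d‖t‖², and ‖s‖ = ‖t‖ for d > 0
(`IsUnitaryMatrix.rTensor_eq_lTensor_adjoint`).

A `*`-cohomomorphism into a special Frobenius algebra is CP because the operator in the CP condition
is an orthogonal projection. It is idempotent by compatibility with comultiplication,
coassociativity and speciality, and self-adjoint by the cup relation (`isCP_of_cup`).

Invertibility is ∑ a_jk† a_jk = d = ∑ a_jk a_jk†, with the powers of d cancelling (`entComp_eq_id`).
Naturality of u is that of the entries; for v one applies it to the dagger of the morphism and takes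
adjoints. -/

lemma adjoint_isometry {V W : Type} [NormedAddCommGroup V] [InnerProductSpace ℂ V]
    [NormedAddCommGroup W] [InnerProductSpace ℂ W] [FiniteDimensional ℂ V]
    [FiniteDimensional ℂ W] (e : V ≃ₗᵢ[ℂ] W) :
    LinearMap.adjoint e.toLinearEquiv.toLinearMap = e.symm.toLinearEquiv.toLinearMap :=
  ((LinearMap.eq_adjoint_iff _ _).2 fun y x => e.symm.inner_map_eq_flip y x).symm

namespace FHilb

lemma dag_comp {X Y Z : FHilb} (f : X ⟶ Y) (g : Y ⟶ Z) : dag (f ≫ g) = dag g ≫ dag f :=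
  DaggerCategory.dagger_comp f g

lemma dag_dag {X Y : FHilb} (f : X ⟶ Y) : dag (dag f) = f := DaggerCategory.dagger_dagger f

lemma dag_whiskerLeft (V : FHilb) {W X : FHilb} (f : W ⟶ X) : dag (V ◁ f) = V ◁ dag f :=
  hom_ext (LinearMap.adjoint_lTensor f.lin)

lemma dag_whiskerRight {W X : FHilb} (f : W ⟶ X) (V : FHilb) : dag (f ▷ V) = dag f ▷ V :=
  hom_ext (LinearMap.adjoint_rTensor f.lin)

lemma dag_tensorHom {V W X Y : FHilb} (f : V ⟶ W) (g : X ⟶ Y) :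
    dag (f ⊗ₘ g) = dag f ⊗ₘ dag g :=
  hom_ext (TensorProduct.adjoint_map f.lin g.lin)

lemma dag_associator_hom (V W X : FHilb) : dag (α_ V W X).hom = (α_ V W X).inv :=
  hom_ext (adjoint_isometry (TensorProduct.assocIsometry ℂ V W X))

lemma dag_associator_inv (V W X : FHilb) : dag (α_ V W X).inv = (α_ V W X).hom := by
  rw [← dag_associator_hom, dag_dag]

lemma dag_leftUnitor_hom (V : FHilb) : dag (λ_ V).hom = (λ_ V).inv :=
  hom_ext (adjoint_isometry (TensorProduct.lidIsometry ℂ V))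

lemma dag_leftUnitor_inv (V : FHilb) : dag (λ_ V).inv = (λ_ V).hom := by
  rw [← dag_leftUnitor_hom, dag_dag]

lemma dag_rightUnitor_hom (V : FHilb) : dag (ρ_ V).hom = (ρ_ V).inv :=
  hom_ext (adjoint_isometry (TensorProduct.ridIsometry ℂ V))

lemma dag_braiding_hom (V W : FHilb) : dag (β_ V W).hom = (β_ V W).inv :=
  hom_ext (adjoint_isometry (TensorProduct.commIsometry ℂ V W))

lemma dag_tensorμ (V W X Y : FHilb) : dag (tensorμ V W X Y) = tensorδ V W X Y := by
  simp only [tensorμ, tensorδ, dag_comp, dag_whiskerLeft, dag_whiskerRight, dag_associator_hom,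
    dag_associator_inv, dag_braiding_hom, Category.assoc]

end FHilb

/-! ### Images of special Frobenius algebras under fibre functors -/

section MapAlg

open Functor.LaxMonoidal Functor.OplaxMonoidal

variable {C : Type u} [Category.{v} C] [MonoidalCategory C] [DaggerCategory C]
  [Preadditive C] [Linear ℂ C] (F : FibreFunctor C)

/-- Both the dagger and `δ` are inverse to `μ`: the first by unitarity, the second by strong
monoidality. This is what lets the comultiplication m† of an algebra be transported through the
functor. -/
lemma FibreFunctor.dag_μ (X Y : C) : dag (μ F.functor X Y) = δ F.functor X Y := by
  rw [← cancel_epi (μ F.functor X Y), (F.unitary_μ X Y).1, Functor.Monoidal.μ_δ]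

lemma FibreFunctor.dag_ε : dag (ε F.functor) = η F.functor := by
  rw [← cancel_epi (ε F.functor), F.unitary_ε.1, Functor.Monoidal.ε_η]

lemma FibreFunctor.mul_mapAlg (A : Mon C) :
    mul (F.mapAlg A) = μ F.functor A.X A.X ≫ F.functor.map (mul A) := rfl

lemma FibreFunctor.one_mapAlg (A : Mon C) :
    one (F.mapAlg A) = ε F.functor ≫ F.functor.map (one A) := rfl

lemma FibreFunctor.dag_μ_map {X Y Z : C} (f : X ⊗ Y ⟶ Z) :
    dag (μ F.functor X Y ≫ F.functor.map f) = F.functor.map (dag f) ≫ δ F.functor X Y := by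
  rw [FHilb.dag_comp, F.dag_μ, ← F.map_dag]

lemma FibreFunctor.comul_mapAlg (A : Mon C) :
    comul (F.mapAlg A) = F.functor.map (comul A) ≫ δ F.functor A.X A.X :=
  F.dag_μ_map (mul A)

lemma FibreFunctor.counit_mapAlg (A : Mon C) :
    counit (F.mapAlg A) = F.functor.map (counit A) ≫ η F.functor := by
  have h : dag (ε F.functor ≫ F.functor.map (one A)) = F.functor.map (counit A) ≫ η F.functor := by
    rw [FHilb.dag_comp, F.dag_ε, ← F.map_dag]
  exact h

/-- Each equation is the image under the functor of the one for `A`: with the dagger of `μ` equal to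
`δ`, the inner structure maps cancel in pairs. -/
lemma FibreFunctor.isSpecialFrobenius_mapAlg {A : Mon C} (hA : IsSpecialFrobenius A) :
    IsSpecialFrobenius (F.mapAlg A) where
  frobenius := by
    have k1 : F.functor.obj A.X ◁ dag (μ F.functor A.X A.X ≫ F.functor.map (mul A)) ≫
        (α_ (F.functor.obj A.X) (F.functor.obj A.X) (F.functor.obj A.X)).inv ≫
        (μ F.functor A.X A.X ≫ F.functor.map (mul A)) ▷ F.functor.obj A.X =
        (μ F.functor A.X A.X ≫ F.functor.map (mul A)) ≫
          dag (μ F.functor A.X A.X ≫ F.functor.map (mul A)) := by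
      simp only [F.dag_μ_map, Category.assoc, ← F.functor.map_comp_assoc, ← hA.frobenius.1]
      simp only [Functor.map_comp, Functor.Monoidal.map_whiskerLeft,
        Functor.Monoidal.map_associator_inv, Functor.Monoidal.map_whiskerRight, Category.assoc,
        Functor.Monoidal.μ_δ_assoc, Functor.Monoidal.μ_δ, Category.comp_id,
        MonoidalCategory.whiskerLeft_comp, comp_whiskerRight]
    have k2 : dag (μ F.functor A.X A.X ≫ F.functor.map (mul A)) ▷ F.functor.obj A.X ≫
        (α_ (F.functor.obj A.X) (F.functor.obj A.X) (F.functor.obj A.X)).hom ≫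
        F.functor.obj A.X ◁ (μ F.functor A.X A.X ≫ F.functor.map (mul A)) =
        (μ F.functor A.X A.X ≫ F.functor.map (mul A)) ≫
          dag (μ F.functor A.X A.X ≫ F.functor.map (mul A)) := by
      simp only [F.dag_μ_map, Category.assoc, ← F.functor.map_comp_assoc, ← hA.frobenius.2]
      simp only [Functor.map_comp, Functor.Monoidal.map_whiskerLeft,
        Functor.Monoidal.map_associator, Functor.Monoidal.map_whiskerRight, Category.assoc,
        Functor.Monoidal.μ_δ_assoc, Functor.Monoidal.μ_δ, Category.comp_id,
        MonoidalCategory.whiskerLeft_comp, comp_whiskerRight]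
    exact ⟨k1, k2⟩
  special := by
    have k : dag (μ F.functor A.X A.X ≫ F.functor.map (mul A)) ≫
        μ F.functor A.X A.X ≫ F.functor.map (mul A) = 𝟙 (F.functor.obj A.X) := by
      rw [F.dag_μ_map, Category.assoc, Functor.Monoidal.δ_μ_assoc, ← F.functor.map_comp,
        ← F.functor.map_id]
      exact congrArg F.functor.map hA.special
    exact k

end MapAlg

/-! ### Frobenius algebras and cups -/

section Monoidal

variable {C : Type u} [Category.{v} C] [MonoidalCategory C]

/-- Coassociativity collects the two copies of `c`, after which the two copies of `r` merge into one
by `hr`. With r = n(f ⊗ 1), for n the multiplication of the target, the idempotent is the operator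
of the CP condition. -/
lemma comp_self_of_coassoc_of_action {A B : C} {c : A ⟶ A ⊗ A} {r : A ⊗ B ⟶ B}
    (hc : c ≫ c ▷ A = c ≫ A ◁ c ≫ (α_ A A A).inv)
    (hr : c ▷ B ≫ (α_ A A B).hom ≫ A ◁ r ≫ r = r) :
    (c ▷ B ≫ (α_ A A B).hom ≫ A ◁ r) ≫ (c ▷ B ≫ (α_ A A B).hom ≫ A ◁ r) =
      c ▷ B ≫ (α_ A A B).hom ≫ A ◁ r := by
  calc _ = (c ≫ c ▷ A) ▷ B ≫ (α_ (A ⊗ A) A B).hom ≫ (A ⊗ A) ◁ r ≫ (α_ A A B).hom ≫ A ◁ r := by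
        simp only [Category.assoc, whisker_exchange_assoc, comp_whiskerRight,
          associator_naturality_left_assoc]
    _ = c ▷ B ≫ (α_ A A B).hom ≫ A ◁ (c ▷ B ≫ (α_ A A B).hom ≫ A ◁ r ≫ r) := by
        rw [hc]
        monoidal
    _ = _ := by rw [hr]

/-- Associativity turns the double action into multiplication by m(f ⊗ f)c = m c' f, and speciality
reduces this to f. -/
lemma action_of_comul_hom {A B : C} {c : A ⟶ A ⊗ A} {c' : B ⟶ B ⊗ B} {m : B ⊗ B ⟶ B}
    {f : A ⟶ B} (hf : f ≫ c' = c ≫ (f ⊗ₘ f)) (hs : c' ≫ m = 𝟙 B)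
    (hm : m ▷ B ≫ m = (α_ B B B).hom ≫ B ◁ m ≫ m) :
    c ▷ B ≫ (α_ A A B).hom ≫ A ◁ (f ▷ B ≫ m) ≫ f ▷ B ≫ m = f ▷ B ≫ m := by
  calc _ = (c ≫ (f ⊗ₘ f)) ▷ B ≫ (α_ B B B).hom ≫ B ◁ m ≫ m := by
        rw [whisker_exchange_assoc]
        simp only [MonoidalCategory.whiskerLeft_comp, comp_whiskerRight, Category.assoc,
          MonoidalCategory.tensorHom_def]
        monoidal
    _ = (f ≫ c') ▷ B ≫ m ▷ B ≫ m := by rw [hf, hm]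
    _ = f ▷ B ≫ (c' ≫ m) ▷ B ≫ m := by monoidal
    _ = _ := by rw [hs, id_whiskerRight, Category.id_comp]

/-- Inserting the unit on one side of the Frobenius equation shows that the comultiplication is
determined by the multiplication and the cup. -/
lemma comul_eq_of_cup {A : C} {m : A ⊗ A ⟶ A} {c : A ⟶ A ⊗ A} {e : 𝟙_ C ⟶ A}
    (he : A ◁ e ≫ m = (ρ_ A).hom) (hF : A ◁ c ≫ (α_ A A A).inv ≫ m ▷ A = m ≫ c) :
    c = (ρ_ A).inv ≫ A ◁ (e ≫ c) ≫ (α_ A A A).inv ≫ m ▷ A := by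
  rw [MonoidalCategory.whiskerLeft_comp, Category.assoc, hF, reassoc_of% he, Iso.inv_hom_id_assoc]

lemma comul_eq_of_cup' {A : C} {m : A ⊗ A ⟶ A} {c : A ⟶ A ⊗ A} {e : 𝟙_ C ⟶ A}
    (he : e ▷ A ≫ m = (λ_ A).hom) (hF : c ▷ A ≫ (α_ A A A).hom ≫ A ◁ m = m ≫ c) :
    c = (λ_ A).inv ≫ (e ≫ c) ▷ A ≫ (α_ A A A).hom ≫ A ◁ m := by
  rw [comp_whiskerRight, Category.assoc, hF, reassoc_of% he, Iso.inv_hom_id_assoc]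

/-- Sliding `f` through the cup `p` turns it into `g` on the cup `q`; the snake formed by `q` and
`s` then straightens. -/
lemma transpose_eq_of_cup {A B : C} {f : A ⟶ B} {g : B ⟶ A} {p : 𝟙_ C ⟶ A ⊗ A}
    {q : 𝟙_ C ⟶ B ⊗ B} {s : B ⊗ B ⟶ 𝟙_ C} (h : p ≫ A ◁ f = q ≫ g ▷ B)
    (hs : (λ_ B).inv ≫ q ▷ B ≫ (α_ B B B).hom ≫ B ◁ s ≫ (ρ_ B).hom = 𝟙 B) :
    g = (λ_ B).inv ≫ p ▷ B ≫ (α_ A A B).hom ≫ A ◁ (f ▷ B ≫ s) ≫ (ρ_ A).hom := by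
  symm
  calc _ = (λ_ B).inv ≫ (p ≫ A ◁ f) ▷ B ≫ (α_ A B B).hom ≫ A ◁ s ≫ (ρ_ A).hom := by monoidal
    _ = ((λ_ B).inv ≫ q ▷ B ≫ (α_ B B B).hom ≫ B ◁ s ≫ (ρ_ B).hom) ≫ g := by
      rw [h]
      simp only [comp_whiskerRight, Category.assoc, associator_naturality_left_assoc,
        ← whisker_exchange_assoc, rightUnitor_naturality]
    _ = g := by rw [hs, Category.id_comp]

/-- Writing `c` and `c'` through their cups lets the relation `h` move the middle morphism across.
When c, c', g are the daggers of m, n, f, the two sides are daggers of each other, so the equation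
expresses self-adjointness. -/
lemma sandwich_eq_of_cup {A B : C} {f : A ⟶ B} {g : B ⟶ A} {m : A ⊗ A ⟶ A} {n : B ⊗ B ⟶ B}
    {c : A ⟶ A ⊗ A} {c' : B ⟶ B ⊗ B} {p : 𝟙_ C ⟶ A ⊗ A} {q : 𝟙_ C ⟶ B ⊗ B}
    (h : p ≫ A ◁ f = q ≫ g ▷ B)
    (hc : c = (ρ_ A).inv ≫ A ◁ p ≫ (α_ A A A).inv ≫ m ▷ A)
    (hc' : c' = (λ_ B).inv ≫ q ▷ B ≫ (α_ B B B).hom ≫ B ◁ n) :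
    c ▷ B ≫ (α_ A A B).hom ≫ A ◁ (f ▷ B ≫ n) =
      A ◁ (c' ≫ g ▷ B) ≫ (α_ A A B).inv ≫ m ▷ B := by
  calc _ = ((ρ_ A).inv ≫ A ◁ p ≫ (α_ A A A).inv ≫ (m ▷ A ≫ A ◁ f)) ▷ B ≫
        (α_ A B B).hom ≫ A ◁ n := by rw [hc]; monoidal
    _ = ((ρ_ A).inv ≫ A ◁ (p ≫ A ◁ f) ≫ (α_ A A B).inv) ▷ B ≫
        (α_ (A ⊗ A) B B).hom ≫ m ▷ (B ⊗ B) ≫ A ◁ n := by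
      rw [← whisker_exchange]; monoidal
    _ = ((ρ_ A).inv ≫ A ◁ q) ▷ B ≫ (α_ A (B ⊗ B) B).hom ≫ A ◁ ((α_ B B B).hom ≫
        g ▷ (B ⊗ B) ≫ A ◁ n) ≫ (α_ A A B).inv ≫ m ▷ B := by
      rw [h, ← whisker_exchange]; monoidal
    _ = _ := by
      rw [← whisker_exchange, hc']; monoidal

end Monoidal

/-! ### Frobenius algebras of Hilbert spaces: snake equation, CP condition and involution. -/

lemma comul_coassoc (A : Mon FHilb) :
    comul A ≫ comul A ▷ A.X = comul A ≫ A.X ◁ comul A ≫ (α_ A.X A.X A.X).inv := by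
  have h := congrArg (fun t => dag t) (MonObj.mul_assoc A.X)
  simp only [FHilb.dag_comp, FHilb.dag_whiskerLeft, FHilb.dag_whiskerRight,
    FHilb.dag_associator_hom, Category.assoc] at h
  exact h

lemma comul_whiskerLeft_counit (A : Mon FHilb) :
    comul A ≫ A.X ◁ counit A = (ρ_ A.X).inv := by
  rw [← FHilb.dag_whiskerLeft, ← FHilb.dag_comp, MonObj.mul_one, FHilb.dag_rightUnitor_hom]

/-- This is the counit law with the comultiplication expressed through the cup. -/
lemma IsFrobenius.snake {A : Mon FHilb} (hA : IsFrobenius A) :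
    (λ_ A.X).inv ≫ frobCup A ▷ A.X ≫ (α_ A.X A.X A.X).hom ≫ A.X ◁ frobCap A ≫ (ρ_ A.X).hom =
      𝟙 A.X := by
  have h := comul_eq_of_cup' (MonObj.one_mul A.X) hA.2
  have h' := comul_whiskerLeft_counit A
  rw [h] at h'
  simp only [Category.assoc] at h'
  rw [frobCup, frobCap, MonoidalCategory.whiskerLeft_comp, Category.assoc]
  have h'' := congrArg (fun t => t ≫ (ρ_ A.X).hom) h'
  simpa only [Category.assoc, Iso.inv_hom_id] using h''

/-- The operator P of the CP condition is an orthogonal projection, so P = P†P and P itself serves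
as the witness. -/
lemma isCP_of_cup {A B : Mon FHilb} (hA : IsFrobenius A) (hB : IsSpecialFrobenius B)
    {f : A.X ⟶ B.X} (hf : f ≫ comul B = comul A ≫ (f ⊗ₘ f))
    (h : frobCup A ≫ A.X ◁ f = frobCup B ≫ dag f ▷ B.X) : IsCP A B f := by
  have hP := comp_self_of_coassoc_of_action (comul_coassoc A)
    (action_of_comul_hom hf hB.special (MonObj.mul_assoc B.X))
  refine ⟨A.X ⊗ B.X, comul A ▷ B.X ≫ (α_ A.X A.X B.X).hom ≫ A.X ◁ (f ▷ B.X ≫ mul B), ?_⟩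
  -- The first rewrite puts both sides in the form with the dagger of `f`; taking the dagger of that
  -- form returns the form with `f`, and a second rewrite makes the sides agree.
  have hdag : dag (comul A ▷ B.X ≫ (α_ A.X A.X B.X).hom ≫ A.X ◁ (f ▷ B.X ≫ mul B)) =
      comul A ▷ B.X ≫ (α_ A.X A.X B.X).hom ≫ A.X ◁ (f ▷ B.X ≫ mul B) := by
    rw [sandwich_eq_of_cup h (comul_eq_of_cup (MonObj.mul_one A.X) hA.1)
      (comul_eq_of_cup' (MonObj.one_mul B.X) hB.frobenius.2)]
    simp only [FHilb.dag_comp, FHilb.dag_whiskerLeft, FHilb.dag_whiskerRight,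
      FHilb.dag_associator_inv, FHilb.dag_dag, Category.assoc]
    rw [sandwich_eq_of_cup h (comul_eq_of_cup (MonObj.mul_one A.X) hA.1)
      (comul_eq_of_cup' (MonObj.one_mul B.X) hB.frobenius.2)]
  rw [hdag]
  exact hP.symm

lemma isStarCohom_of_cup {A B : Mon FHilb} (hB : IsFrobenius B) {f : A.X ⟶ B.X}
    (hf : f ≫ comul B = comul A ≫ (f ⊗ₘ f)) (hu : f ≫ counit B = counit A)
    (h : frobCup A ≫ A.X ◁ f = frobCup B ≫ dag f ▷ B.X) : IsStarCohom A B f where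
  comul := hf
  counit := hu
  star := transpose_eq_of_cup h hB.snake

/-! ### Tensor products of special Frobenius algebras of Hilbert spaces -/

section LinearTensor

variable {V W : Type*} [AddCommGroup V] [Module ℂ V] [AddCommGroup W] [Module ℂ W]
  (m : V ⊗[ℂ] V →ₗ[ℂ] V) (n : W ⊗[ℂ] W →ₗ[ℂ] W)

/-- The tensors `s` and `t` are arbitrary because they are going to be values of the two
comultiplications; the lemma separates a Frobenius expression for a product algebra into its
factors. -/
lemma map_mul_rTensor_shuffle (v : V) (w : W) (s : V ⊗[ℂ] V) (t : W ⊗[ℂ] W) :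
    (TensorProduct.map m n ∘ₗ (tensorTensorTensorComm ℂ V W V W).toLinearMap).rTensor (V ⊗[ℂ] W)
      ((TensorProduct.assoc ℂ _ _ _).symm
        ((v ⊗ₜ w) ⊗ₜ tensorTensorTensorComm ℂ V V W W (s ⊗ₜ t))) =
      tensorTensorTensorComm ℂ V V W W
        (m.rTensor V ((TensorProduct.assoc ℂ _ _ _).symm (v ⊗ₜ s)) ⊗ₜ
          n.rTensor W ((TensorProduct.assoc ℂ _ _ _).symm (w ⊗ₜ t))) := by
  induction s with
  | zero => simp
  | add s₁ s₂ h₁ h₂ => simp only [TensorProduct.add_tmul, TensorProduct.tmul_add, map_add, h₁, h₂]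
  | tmul v₁ v₂ =>
    induction t with
    | zero => simp
    | add s₁ s₂ h₁ h₂ => simp only [TensorProduct.tmul_add, map_add, h₁, h₂]
    | tmul w₁ w₂ => simp

lemma map_mul_lTensor_shuffle (v : V) (w : W) (s : V ⊗[ℂ] V) (t : W ⊗[ℂ] W) :
    (TensorProduct.map m n ∘ₗ (tensorTensorTensorComm ℂ V W V W).toLinearMap).lTensor (V ⊗[ℂ] W)
      (TensorProduct.assoc ℂ _ _ _
        (tensorTensorTensorComm ℂ V V W W (s ⊗ₜ t) ⊗ₜ (v ⊗ₜ w))) =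
      tensorTensorTensorComm ℂ V V W W
        (m.lTensor V (TensorProduct.assoc ℂ _ _ _ (s ⊗ₜ v)) ⊗ₜ
          n.lTensor W (TensorProduct.assoc ℂ _ _ _ (t ⊗ₜ w))) := by
  induction s with
  | zero => simp
  | add s₁ s₂ h₁ h₂ => simp only [TensorProduct.add_tmul, map_add, h₁, h₂]
  | tmul v₁ v₂ =>
    induction t with
    | zero => simp
    | add s₁ s₂ h₁ h₂ => simp only [TensorProduct.tmul_add, TensorProduct.add_tmul, map_add, h₁, h₂]
    | tmul w₁ w₂ => simp

end LinearTensor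

namespace FHilb

lemma tensorμ_lin (V W X Y : FHilb) :
    (tensorμ V W X Y).lin = (tensorTensorTensorComm ℂ V W X Y).toLinearMap :=
  TensorProduct.ext (TensorProduct.ext' fun _ _ => TensorProduct.ext' fun _ _ => rfl)

lemma tensorδ_lin (V W X Y : FHilb) :
    (tensorδ V W X Y).lin = (tensorTensorTensorComm ℂ V X W Y).toLinearMap :=
  TensorProduct.ext (TensorProduct.ext' fun _ _ => TensorProduct.ext' fun _ _ => rfl)

end FHilb

lemma comul_tensor (A B : Mon FHilb) :
    comul (A ⊗ B) = (comul A ⊗ₘ comul B) ≫ tensorδ A.X B.X A.X B.X := by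
  have h : dag (tensorμ A.X B.X A.X B.X ≫ (mul A ⊗ₘ mul B)) =
      (comul A ⊗ₘ comul B) ≫ tensorδ A.X B.X A.X B.X := by
    rw [FHilb.dag_comp, FHilb.dag_tensorHom, FHilb.dag_tensorμ]
  exact h

lemma counit_tensor (A B : Mon FHilb) :
    counit (A ⊗ B) = (counit A ⊗ₘ counit B) ≫ (λ_ (𝟙_ FHilb)).hom := by
  have h : dag ((λ_ (𝟙_ FHilb)).inv ≫ (one A ⊗ₘ one B)) =
      (counit A ⊗ₘ counit B) ≫ (λ_ (𝟙_ FHilb)).hom := by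
    rw [FHilb.dag_comp, FHilb.dag_tensorHom, FHilb.dag_leftUnitor_inv]
  exact h

lemma mul_tensor_lin (A B : Mon FHilb) :
    (mul (A ⊗ B)).lin = TensorProduct.map (mul A).lin (mul B).lin ∘ₗ
      (tensorTensorTensorComm ℂ A.X B.X A.X B.X).toLinearMap :=
  congrArg (fun t => TensorProduct.map (mul A).lin (mul B).lin ∘ₗ t) (FHilb.tensorμ_lin _ _ _ _)

lemma comul_tensor_lin (A B : Mon FHilb) :
    (comul (A ⊗ B)).lin = (tensorTensorTensorComm ℂ A.X A.X B.X B.X).toLinearMap ∘ₗ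
      TensorProduct.map (comul A).lin (comul B).lin := by
  rw [comul_tensor]
  exact congrArg (fun t => t ∘ₗ TensorProduct.map (comul A).lin (comul B).lin)
    (FHilb.tensorδ_lin _ _ _ _)

/-- On pure tensors the shuffle lemmas split each Frobenius equation into those of the two factors.
Speciality needs only that the two middle swaps cancel. -/
lemma IsSpecialFrobenius.tensor {A B : Mon FHilb} (hA : IsSpecialFrobenius A)
    (hB : IsSpecialFrobenius B) : IsSpecialFrobenius (A ⊗ B) where
  frobenius := by
    constructor
    · have k : (TensorProduct.map (mul A).lin (mul B).lin ∘ₗ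
          (tensorTensorTensorComm ℂ A.X B.X A.X B.X).toLinearMap).rTensor (A.X ⊗[ℂ] B.X) ∘ₗ
          (TensorProduct.assoc ℂ _ _ _).symm.toLinearMap ∘ₗ
          ((tensorTensorTensorComm ℂ A.X A.X B.X B.X).toLinearMap ∘ₗ
            TensorProduct.map (comul A).lin (comul B).lin).lTensor (A.X ⊗[ℂ] B.X) =
          ((tensorTensorTensorComm ℂ A.X A.X B.X B.X).toLinearMap ∘ₗ
            TensorProduct.map (comul A).lin (comul B).lin) ∘ₗ
          (TensorProduct.map (mul A).lin (mul B).lin ∘ₗ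
            (tensorTensorTensorComm ℂ A.X B.X A.X B.X).toLinearMap) := by
        refine TensorProduct.ext (TensorProduct.ext' fun v w => TensorProduct.ext' fun v' w' => ?_)
        refine (map_mul_rTensor_shuffle (mul A).lin (mul B).lin v w ((comul A).lin v')
          ((comul B).lin w')).trans ?_
        exact congrArg₂ (fun s t => tensorTensorTensorComm ℂ A.X A.X B.X B.X (s ⊗ₜ t))
          (LinearMap.congr_fun (congrArg FHilb.Hom.lin hA.frobenius.1) (v ⊗ₜ v'))
          (LinearMap.congr_fun (congrArg FHilb.Hom.lin hB.frobenius.1) (w ⊗ₜ w'))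
      rw [← comul_tensor_lin, ← mul_tensor_lin] at k
      exact FHilb.hom_ext k
    · have k : (TensorProduct.map (mul A).lin (mul B).lin ∘ₗ
          (tensorTensorTensorComm ℂ A.X B.X A.X B.X).toLinearMap).lTensor (A.X ⊗[ℂ] B.X) ∘ₗ
          (TensorProduct.assoc ℂ _ _ _).toLinearMap ∘ₗ
          ((tensorTensorTensorComm ℂ A.X A.X B.X B.X).toLinearMap ∘ₗ
            TensorProduct.map (comul A).lin (comul B).lin).rTensor (A.X ⊗[ℂ] B.X) =
          ((tensorTensorTensorComm ℂ A.X A.X B.X B.X).toLinearMap ∘ₗ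
            TensorProduct.map (comul A).lin (comul B).lin) ∘ₗ
          (TensorProduct.map (mul A).lin (mul B).lin ∘ₗ
            (tensorTensorTensorComm ℂ A.X B.X A.X B.X).toLinearMap) := by
        refine TensorProduct.ext (TensorProduct.ext' fun v w => TensorProduct.ext' fun v' w' => ?_)
        refine (map_mul_lTensor_shuffle (mul A).lin (mul B).lin v' w' ((comul A).lin v)
          ((comul B).lin w)).trans ?_
        exact congrArg₂ (fun s t => tensorTensorTensorComm ℂ A.X A.X B.X B.X (s ⊗ₜ t))
          (LinearMap.congr_fun (congrArg FHilb.Hom.lin hA.frobenius.2) (v ⊗ₜ v'))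
          (LinearMap.congr_fun (congrArg FHilb.Hom.lin hB.frobenius.2) (w ⊗ₜ w'))
      rw [← comul_tensor_lin, ← mul_tensor_lin] at k
      exact FHilb.hom_ext k
  special := by
    have h : ((comul A ⊗ₘ comul B) ≫ tensorδ A.X B.X A.X B.X) ≫
        tensorμ A.X B.X A.X B.X ≫ (mul A ⊗ₘ mul B) = 𝟙 (A.X ⊗ B.X) := by
      rw [Category.assoc, tensorδ_tensorμ_assoc, tensorHom_comp_tensorHom]
      exact (congrArg₂ (fun f g => f ⊗ₘ g) hA.special hB.special).trans (id_tensorHom_id _ _)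
    rw [← comul_tensor] at h
    exact h

/-! ### The special Frobenius algebra `B(H)` -/

section LinearMatrix

variable {V : Type*} [AddCommGroup V] [Module ℂ V] {ι : Type*} [Fintype ι] {e : ι → V}
  {k : V → V → ℂ} {c : ℂ} {m : (V ⊗[ℂ] V) ⊗[ℂ] (V ⊗[ℂ] V) →ₗ[ℂ] V ⊗[ℂ] V}
  {δ : V ⊗[ℂ] V →ₗ[ℂ] (V ⊗[ℂ] V) ⊗[ℂ] (V ⊗[ℂ] V)}

/-- Multiplication contracts the two inner legs by `k`, while `δ` inserts ∑ e_l ⊗ e_l between the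
outer ones. These happen at different places, so no relation between `k`, `c` and `e` is required;
only speciality fixes the normalisation. -/
lemma matrix_frobenius_left
    (hm : ∀ x y z w, m ((x ⊗ₜ y) ⊗ₜ (z ⊗ₜ w)) = k y z • (x ⊗ₜ w))
    (hδ : ∀ x y, δ (x ⊗ₜ y) = c • ∑ l, (x ⊗ₜ e l) ⊗ₜ (e l ⊗ₜ y)) :
    m.rTensor (V ⊗[ℂ] V) ∘ₗ (TensorProduct.assoc ℂ _ _ _).symm.toLinearMap ∘ₗ
      δ.lTensor (V ⊗[ℂ] V) = δ ∘ₗ m := by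
  refine TensorProduct.ext (TensorProduct.ext' fun x y => TensorProduct.ext' fun z w => ?_)
  simp [hm, hδ, TensorProduct.tmul_sum, ← TensorProduct.smul_tmul', Finset.smul_sum, smul_smul,
    mul_comm]

lemma matrix_frobenius_right
    (hm : ∀ x y z w, m ((x ⊗ₜ y) ⊗ₜ (z ⊗ₜ w)) = k y z • (x ⊗ₜ w))
    (hδ : ∀ x y, δ (x ⊗ₜ y) = c • ∑ l, (x ⊗ₜ e l) ⊗ₜ (e l ⊗ₜ y)) :
    m.lTensor (V ⊗[ℂ] V) ∘ₗ (TensorProduct.assoc ℂ _ _ _).toLinearMap ∘ₗ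
      δ.rTensor (V ⊗[ℂ] V) = δ ∘ₗ m := by
  refine TensorProduct.ext (TensorProduct.ext' fun x y => TensorProduct.ext' fun z w => ?_)
  simp [hm, hδ, TensorProduct.sum_tmul, ← TensorProduct.smul_tmul', Finset.smul_sum, smul_smul,
    mul_comm]

lemma matrix_special
    (hm : ∀ x y z w, m ((x ⊗ₜ y) ⊗ₜ (z ⊗ₜ w)) = k y z • (x ⊗ₜ w))
    (hδ : ∀ x y, δ (x ⊗ₜ y) = c • ∑ l, (x ⊗ₜ e l) ⊗ₜ (e l ⊗ₜ y))
    (hk : c * ∑ l, k (e l) (e l) = 1) : m ∘ₗ δ = LinearMap.id := by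
  refine TensorProduct.ext' fun x y => ?_
  simp [hm, hδ, ← Finset.sum_smul, smul_smul, hk]

end LinearMatrix

section BH

variable {ι : Type*} [Fintype ι] {H : FHilb} (b : OrthonormalBasis ι ℂ H)

lemma FHilb.dag_smul {V W : FHilb} (c : ℂ) (f : V ⟶ W) : dag (c • f) = star c • dag f :=
  FHilb.hom_ext (map_smulₛₗ LinearMap.adjoint c f.lin)

lemma inner_cap_left {V : Type} [NormedAddCommGroup V] [InnerProductSpace ℂ V]
    (b : OrthonormalBasis ι ℂ V) (t : V ⊗[ℂ] V) (c : ℂ) :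
    ⟪(∑ i, LinearMap.mul' ℂ ℂ ∘ₗ TensorProduct.map (innerₛₗ ℂ (b i)) (innerₛₗ ℂ (b i)) :
      V ⊗[ℂ] V →ₗ[ℂ] ℂ) t, c⟫_ℂ = ⟪t, c • ∑ i, b i ⊗ₜ[ℂ] b i⟫_ℂ := by
  induction t with
  | zero => simp
  | add s t hs ht => rw [map_add, inner_add_left, inner_add_left, hs, ht]
  | tmul x y =>
    refine Eq.symm ((inner_smul_right _ _ _).trans
      ((congrArg (c * ·) (inner_sum _ _ _)).trans ?_))
    simp [Finset.mul_sum]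

lemma dag_cup : dag (cup b) = cap b := by
  refine FHilb.hom_ext (Eq.symm ?_)
  exact (LinearMap.eq_adjoint_iff _ _).2 fun t (c : ℂ) => inner_cap_left b t c

lemma dag_cap : dag (cap b) = cup b := by rw [← dag_cup, FHilb.dag_dag]

lemma dag_bhMul : dag (bhMul b) = ((1 / √(dimension b) : ℝ) : ℂ) •
    (H ◁ ((λ_ H).inv ≫ cup b ▷ H ≫ (α_ H H H).hom) ≫ (α_ H H (H ⊗ H)).inv) := by
  rw [bhMul, FHilb.dag_smul]
  simp only [FHilb.dag_comp, FHilb.dag_whiskerLeft, FHilb.dag_whiskerRight,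
    FHilb.dag_associator_inv, FHilb.dag_associator_hom, FHilb.dag_leftUnitor_hom, dag_cap,
    Category.assoc]
  congr 1
  exact Complex.conj_ofReal _

lemma cup_one : (cup b).lin (1 : ℂ) = ∑ i, b i ⊗ₜ[ℂ] b i := one_smul ℂ _

lemma dag_bhMul_tmul (x y : H) :
    (dag (bhMul b)).lin (x ⊗ₜ[ℂ] y) =
      ((1 / √(dimension b) : ℝ) : ℂ) • ∑ l, (x ⊗ₜ[ℂ] b l) ⊗ₜ[ℂ] (b l ⊗ₜ[ℂ] y) := by
  rw [dag_bhMul]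
  refine congrArg (fun t : (H ⊗[ℂ] H) ⊗[ℂ] (H ⊗[ℂ] H) => ((1 / √(dimension b) : ℝ) : ℂ) • t) ?_
  change (TensorProduct.assoc ℂ H H (H ⊗[ℂ] H)).symm (x ⊗ₜ[ℂ] TensorProduct.assoc ℂ H H H
    ((cup b).lin (1 : ℂ) ⊗ₜ[ℂ] y)) = _
  rw [cup_one]
  simp [TensorProduct.sum_tmul, TensorProduct.tmul_sum]

lemma dag_bhOne_tmul (x y : H) :
    (dag (bhOne b)).lin (x ⊗ₜ[ℂ] y) = (√(dimension b) : ℂ) * ∑ i, ⟪b i, x⟫_ℂ * ⟪b i, y⟫_ℂ := by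
  rw [bhOne, FHilb.dag_smul, dag_cup, ← cap_tmul]
  exact congrArg (fun t : ℂ => t * (cap b).lin (x ⊗ₜ[ℂ] y)) (Complex.conj_ofReal _)

lemma isSpecialFrobenius_bh [Nonempty ι] : IsSpecialFrobenius (bh b) := by
  have hm : ∀ x y z w : H, (bhMul b).lin ((x ⊗ₜ[ℂ] y) ⊗ₜ[ℂ] (z ⊗ₜ[ℂ] w)) =
      (((1 / √(dimension b) : ℝ) : ℂ) * ∑ i, ⟪b i, y⟫_ℂ * ⟪b i, z⟫_ℂ) • (x ⊗ₜ[ℂ] w) :=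
    bhMul_tmul b
  refine ⟨⟨?_, ?_⟩, ?_⟩
  · exact FHilb.hom_ext (matrix_frobenius_left hm (dag_bhMul_tmul b))
  · exact FHilb.hom_ext (matrix_frobenius_right hm (dag_bhMul_tmul b))
  · refine FHilb.hom_ext (matrix_special hm (dag_bhMul_tmul b) ?_)
    classical
    have h := sqrt_dim_mul b
    have hd : (√(dimension b) : ℂ) * (√(dimension b) : ℂ) = Fintype.card ι := by
      rw [← Complex.ofReal_mul, Real.mul_self_sqrt (Nat.cast_nonneg _)]
      simp
    simp only [b.inner_eq_ite, mul_ite, mul_one, mul_zero, Finset.sum_ite_eq', Finset.mem_univ,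
      if_true, Finset.sum_const, Finset.card_univ, nsmul_eq_mul]
    -- The claim is (d^(-1/2) · d^(1/2))² = 1, so z² - 1 = (z + 1)(z - 1) reduces it to `h`.
    rw [← hd]
    linear_combination (((1 / √(dimension b) : ℝ) : ℂ) * (√(dimension b) : ℂ) + 1) * h

end BH

/-! ### Matrices of operators -/

section Unitary

variable {V W : Type} [NormedAddCommGroup V] [InnerProductSpace ℂ V] [FiniteDimensional ℂ V]
  [NormedAddCommGroup W] [InnerProductSpace ℂ W] [FiniteDimensional ℂ W]
  {ι : Type*} [Fintype ι] [DecidableEq ι]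

/-- A matrix of linear maps is unitary. -/
structure IsUnitaryMatrix (a : ι → ι → V →ₗ[ℂ] W) : Prop where
  adjoint_comp : ∀ j k, ∑ i, LinearMap.adjoint (a i j) ∘ₗ a i k =
    if j = k then LinearMap.id else 0
  comp_adjoint : ∀ i j, ∑ k, a i k ∘ₗ LinearMap.adjoint (a j k) =
    if i = j then LinearMap.id else 0

variable {a : ι → ι → V →ₗ[ℂ] W}

/-- Every column contributes one identity. The resulting d enters both the norm comparison for the
involution and the composite along the maximally entangled state. -/
lemma IsUnitaryMatrix.sum_adjoint_comp (ha : IsUnitaryMatrix a) :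
    ∑ j, ∑ k, LinearMap.adjoint (a j k) ∘ₗ a j k = (Fintype.card ι : ℂ) • LinearMap.id := by
  rw [Finset.sum_comm]
  simp [ha.adjoint_comp, ← Nat.cast_smul_eq_nsmul ℂ]

lemma IsUnitaryMatrix.sum_comp_adjoint (ha : IsUnitaryMatrix a) :
    ∑ j, ∑ k, a j k ∘ₗ LinearMap.adjoint (a j k) = (Fintype.card ι : ℂ) • LinearMap.id := by
  simp [ha.comp_adjoint, ← Nat.cast_smul_eq_nsmul ℂ]

variable {s : V ⊗[ℂ] V} {t : W ⊗[ℂ] W}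

/-- A unitary matrix which maps `s` to `t` intertwines the transposes defined by `s` and `t`. -/
lemma IsUnitaryMatrix.lTensor_eq_rTensor_adjoint (ha : IsUnitaryMatrix a)
    (h : ∀ i j, ∑ k, TensorProduct.map (a i k) (a k j) s = if i = j then t else 0) (l j : ι) :
    (a l j).lTensor V s = (LinearMap.adjoint (a j l)).rTensor W t := by
  -- Apply a_il† to the first leg of `h` and sum over i. On the right only i = j survives; on the
  -- left ∑_i a_il† a_ik = δ_lk leaves only k = l.
  have e : ∀ i, (LinearMap.adjoint (a i l)).rTensor W
      (∑ k, TensorProduct.map (a i k) (a k j) s) =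
      ∑ k, TensorProduct.map (LinearMap.adjoint (a i l) ∘ₗ a i k) (a k j) s := by
    intro i
    rw [map_sum]
    refine Finset.sum_congr rfl fun k _ => ?_
    rw [← LinearMap.comp_apply, LinearMap.rTensor_comp_map]
  have e1 : ∑ i, (LinearMap.adjoint (a i l)).rTensor W
      (∑ k, TensorProduct.map (a i k) (a k j) s) = (LinearMap.adjoint (a j l)).rTensor W t := by
    simp only [h, apply_ite, map_zero]
    simp
  rw [← e1]
  simp only [e]
  rw [Finset.sum_comm]
  have e2 : ∀ k, ∑ i, TensorProduct.map (LinearMap.adjoint (a i l) ∘ₗ a i k) (a k j) s =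
      TensorProduct.map (if l = k then LinearMap.id else 0) (a k j) s := by
    intro k
    rw [← ha.adjoint_comp, ← LinearMap.sum_apply]
    congr 1
    exact (map_sum ((TensorProduct.mapBilinear (RingHom.id ℂ) V V V W).flip (a k j)) _ _).symm
  simp only [e2]
  rw [Finset.sum_eq_single l]
  · simp [LinearMap.lTensor]
  · intro k _ hk
    simp [Ne.symm hk]
  · simp

end Unitary

/-! ### Sums of squared norms over the entries of a matrix of operators. -/

section HilbertSchmidt

variable {E F G : Type} [NormedAddCommGroup E] [InnerProductSpace ℂ E]
  [FiniteDimensional ℂ E] [NormedAddCommGroup F] [InnerProductSpace ℂ F]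
  [FiniteDimensional ℂ F] [NormedAddCommGroup G] [InnerProductSpace ℂ G]
  [FiniteDimensional ℂ G] {ι : Type*} [Fintype ι]

lemma inner_rTensor_rTensor (x : E →ₗ[ℂ] F) (r : E ⊗[ℂ] G) :
    ⟪x.rTensor G r, x.rTensor G r⟫_ℂ = ⟪r, (LinearMap.adjoint x ∘ₗ x).rTensor G r⟫_ℂ := by
  rw [LinearMap.rTensor_comp, ← LinearMap.adjoint_rTensor]
  exact (LinearMap.adjoint_inner_right _ _ _).symm

lemma inner_lTensor_lTensor (x : E →ₗ[ℂ] F) (r : G ⊗[ℂ] E) :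
    ⟪x.lTensor G r, x.lTensor G r⟫_ℂ = ⟪r, (LinearMap.adjoint x ∘ₗ x).lTensor G r⟫_ℂ := by
  rw [LinearMap.lTensor_comp, ← LinearMap.adjoint_lTensor]
  exact (LinearMap.adjoint_inner_right _ _ _).symm

lemma sum_inner_rTensor {x : ι → ι → E →ₗ[ℂ] F} {c : ℂ}
    (h : ∑ j, ∑ k, LinearMap.adjoint (x j k) ∘ₗ x j k = c • LinearMap.id) (r : E ⊗[ℂ] G) :
    ∑ j, ∑ k, ⟪(x j k).rTensor G r, (x j k).rTensor G r⟫_ℂ = c * ⟪r, r⟫_ℂ := by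
  -- The functional y ↦ ⟨r, (y ⊗ 1) r⟩ is linear, so the sum over entries can be taken inside and
  -- evaluated by `h`.
  let φ : (E →ₗ[ℂ] E) →ₗ[ℂ] ℂ :=
    innerₛₗ ℂ r ∘ₗ LinearMap.applyₗ r ∘ₗ LinearMap.rTensorHom G
  have e : ∀ j k, ⟪(x j k).rTensor G r, (x j k).rTensor G r⟫_ℂ =
      φ (LinearMap.adjoint (x j k) ∘ₗ x j k) := fun j k => inner_rTensor_rTensor _ _
  simp only [e, ← map_sum, h, map_smul, smul_eq_mul]
  congr 1
  exact congrArg (fun z => ⟪r, z⟫_ℂ) (LinearMap.rTensor_id_apply G E r)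

lemma sum_inner_lTensor {x : ι → ι → E →ₗ[ℂ] F} {c : ℂ}
    (h : ∑ j, ∑ k, LinearMap.adjoint (x j k) ∘ₗ x j k = c • LinearMap.id) (r : G ⊗[ℂ] E) :
    ∑ j, ∑ k, ⟪(x j k).lTensor G r, (x j k).lTensor G r⟫_ℂ = c * ⟪r, r⟫_ℂ := by
  let φ : (E →ₗ[ℂ] E) →ₗ[ℂ] ℂ :=
    innerₛₗ ℂ r ∘ₗ LinearMap.applyₗ r ∘ₗ LinearMap.lTensorHom G
  have e : ∀ j k, ⟪(x j k).lTensor G r, (x j k).lTensor G r⟫_ℂ =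
      φ (LinearMap.adjoint (x j k) ∘ₗ x j k) := fun j k => inner_lTensor_lTensor _ _
  simp only [e, ← map_sum, h, map_smul, smul_eq_mul]
  congr 1
  exact congrArg (fun z => ⟪r, z⟫_ℂ) (LinearMap.lTensor_id_apply G E r)

end HilbertSchmidt

section Dual

variable {V W : Type} [NormedAddCommGroup V] [InnerProductSpace ℂ V] [FiniteDimensional ℂ V]
  [NormedAddCommGroup W] [InnerProductSpace ℂ W] [FiniteDimensional ℂ W]
  {ι : Type*} [Fintype ι] [DecidableEq ι] {a : ι → ι → V →ₗ[ℂ] W}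

/-- The adjoint matrix entries intertwine the transposes in the opposite direction as well. The
sum of the squared distances of both sides vanishes because `s` and `t` have equal norms. -/
lemma IsUnitaryMatrix.rTensor_eq_lTensor_adjoint (ha : IsUnitaryMatrix a)
    {s : V ⊗[ℂ] V} {t : W ⊗[ℂ] W}
    (h : ∀ i j, ∑ k, TensorProduct.map (a i k) (a k j) s = if i = j then t else 0) (j k : ι) :
    (a j k).rTensor V s = (LinearMap.adjoint (a k j)).lTensor W t := by
  have hstar := ha.lTensor_eq_rTensor_adjoint h
  have h' : ∑ j, ∑ k, LinearMap.adjoint (LinearMap.adjoint (a k j)) ∘ₗ LinearMap.adjoint (a k j) =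
      (Fintype.card ι : ℂ) • LinearMap.id := by
    simp only [LinearMap.adjoint_adjoint]
    rw [Finset.sum_comm, ha.sum_comp_adjoint]
  have h1 := sum_inner_rTensor ha.sum_adjoint_comp s
  have h2 := sum_inner_lTensor h' t
  have h3 := sum_inner_lTensor ha.sum_adjoint_comp s
  have h4 := sum_inner_rTensor h' t
  simp only [← hstar] at h4
  -- Summing the squared norms of the two sides of `hstar` gives d‖s‖² and d‖t‖².
  have hst : (Fintype.card ι : ℂ) * ⟪s, s⟫_ℂ = (Fintype.card ι : ℂ) * ⟪t, t⟫_ℂ := h3.symm.trans h4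
  -- The cross terms: operators on different legs commute, so both factors move to the other side as
  -- adjoints, where `hstar` identifies the two vectors.
  have hx : ∀ j k, ⟪(a j k).rTensor V s, (LinearMap.adjoint (a k j)).lTensor W t⟫_ℂ =
      ⟪(a k j).lTensor V s, (a k j).lTensor V s⟫_ℂ := by
    intro j k
    conv_rhs => enter [3]; rw [hstar]
    rw [← LinearMap.adjoint_lTensor, ← LinearMap.adjoint_rTensor]
    refine (LinearMap.adjoint_inner_right _ _ _).trans
      (Eq.trans ?_ (LinearMap.adjoint_inner_right _ _ _).symm)
    rw [← LinearMap.comp_apply, ← LinearMap.comp_apply, LinearMap.lTensor_comp_rTensor,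
      LinearMap.rTensor_comp_lTensor]
  have hy : ∀ j k, ⟪(LinearMap.adjoint (a k j)).lTensor W t, (a j k).rTensor V s⟫_ℂ =
      ⟪(a k j).lTensor V s, (a k j).lTensor V s⟫_ℂ := by
    intro j k
    refine (inner_conj_symm (𝕜 := ℂ) (E := W ⊗[ℂ] V) _ _).symm.trans ?_
    refine (congrArg (starRingEnd ℂ) (hx j k)).trans ?_
    exact inner_conj_symm (𝕜 := ℂ) (E := V ⊗[ℂ] W) _ _
  have h5 : ∑ j, ∑ k, ⟪(a k j).lTensor V s, (a k j).lTensor V s⟫_ℂ =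
      (Fintype.card ι : ℂ) * ⟪s, s⟫_ℂ := by rw [Finset.sum_comm, h3]
  -- Expanding the squares gives d‖s‖² - d‖s‖² - (d‖s‖² - d‖t‖²), which vanishes by `hst`.
  have key : ∑ j, ∑ k, ⟪(a j k).rTensor V s - (LinearMap.adjoint (a k j)).lTensor W t,
      (a j k).rTensor V s - (LinearMap.adjoint (a k j)).lTensor W t⟫_ℂ = 0 := by
    have e : ∀ j k, ⟪(a j k).rTensor V s - (LinearMap.adjoint (a k j)).lTensor W t,
        (a j k).rTensor V s - (LinearMap.adjoint (a k j)).lTensor W t⟫_ℂ =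
        ⟪(a j k).rTensor V s, (a j k).rTensor V s⟫_ℂ -
        ⟪(a k j).lTensor V s, (a k j).lTensor V s⟫_ℂ -
        (⟪(a k j).lTensor V s, (a k j).lTensor V s⟫_ℂ -
        ⟪(LinearMap.adjoint (a k j)).lTensor W t, (LinearMap.adjoint (a k j)).lTensor W t⟫_ℂ) := by
      intro j k
      refine (inner_sub_left _ _ _).trans ?_
      refine (congrArg₂ (· - ·) (inner_sub_right _ _ _) (inner_sub_right _ _ _)).trans ?_
      rw [hx, hy]
    simp only [e, Finset.sum_sub_distrib, h1, h2, h5]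
    rw [hst]
    ring
  have key' : ∑ j, ∑ k, ‖(a j k).rTensor V s - (LinearMap.adjoint (a k j)).lTensor W t‖ ^ 2 = 0 := by
    have e : ∀ z : W ⊗[ℂ] V, ⟪z, z⟫_ℂ = ((‖z‖ ^ 2 : ℝ) : ℂ) := fun z =>
      (inner_self_eq_norm_sq_to_K z).trans (Complex.ofReal_pow _ _).symm
    simp only [e] at key
    exact_mod_cast key
  have k1 := (Finset.sum_eq_zero_iff_of_nonneg fun _ _ => Finset.sum_nonneg fun _ _ =>
    sq_nonneg _).1 key' j (Finset.mem_univ _)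
  have k2 := (Finset.sum_eq_zero_iff_of_nonneg fun _ _ => sq_nonneg _).1 k1 k (Finset.mem_univ _)
  exact sub_eq_zero.1 (norm_eq_zero.1 (pow_eq_zero_iff two_ne_zero |>.1 k2))

/-- The same relation read for the family of adjoints, with V and W exchanged: the form in which the
involution condition for v is checked. -/
lemma IsUnitaryMatrix.lTensor_adjoint_eq_rTensor (ha : IsUnitaryMatrix a)
    {s : V ⊗[ℂ] V} {t : W ⊗[ℂ] W}
    (h : ∀ i j, ∑ k, TensorProduct.map (a i k) (a k j) s = if i = j then t else 0) (j k : ι) :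
    (LinearMap.adjoint (a j k)).lTensor W t =
      (LinearMap.adjoint (LinearMap.adjoint (a k j))).rTensor V s := by
  rw [LinearMap.adjoint_adjoint, ha.rTensor_eq_lTensor_adjoint h]

end Dual

/-! ### Matrix entries of maps `X ⊗ H → H ⊗ Y` -/

section Entry

variable {X Y H : Type} [NormedAddCommGroup X] [InnerProductSpace ℂ X]
  [NormedAddCommGroup Y] [InnerProductSpace ℂ Y]
  [NormedAddCommGroup H] [InnerProductSpace ℂ H]
  {ι : Type*} [Fintype ι] (b : OrthonormalBasis ι ℂ H)

/-- The matrix entry `x ↦ (⟨i| ⊗ id) β (x ⊗ |j⟩)`. -/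
def entry (β : X ⊗[ℂ] H →ₗ[ℂ] H ⊗[ℂ] Y) (i j : ι) : X →ₗ[ℂ] Y :=
  (TensorProduct.lid ℂ Y).toLinearMap ∘ₗ (innerₛₗ ℂ (b i)).rTensor Y ∘ₗ β ∘ₗ
    (TensorProduct.mk ℂ X H).flip (b j)

lemma entry_apply (β : X ⊗[ℂ] H →ₗ[ℂ] H ⊗[ℂ] Y) (i j : ι) (x : X) :
    entry b β i j x = slice (b i) (β (x ⊗ₜ b j)) := rfl

lemma apply_tmul_basis (β : X ⊗[ℂ] H →ₗ[ℂ] H ⊗[ℂ] Y) (x : X) (j : ι) :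
    β (x ⊗ₜ b j) = ∑ i, b i ⊗ₜ[ℂ] entry b β i j x :=
  (sum_tmul_slice b _).symm

lemma slice_sum_tmul {M : Type*} [AddCommGroup M] [Module ℂ M] (y : ι → M) (i : ι) :
    slice (b i) (∑ k, b k ⊗ₜ[ℂ] y k) = y i := by
  classical
  simp [slice, b.inner_eq_ite]

lemma inner_slice (h : H) (y : Y) (t : H ⊗[ℂ] Y) : ⟪y, slice h t⟫_ℂ = ⟪h ⊗ₜ[ℂ] y, t⟫_ℂ := by
  induction t with
  | zero => simp
  | add s t hs ht => rw [slice_add_right, inner_add_right, inner_add_right, hs, ht]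
  | tmul v w => simp

lemma slice_lTensor {M N : Type*} [AddCommGroup M] [Module ℂ M] [AddCommGroup N] [Module ℂ N]
    (h : H) (f : M →ₗ[ℂ] N) (t : H ⊗[ℂ] M) : slice h (f.lTensor H t) = f (slice h t) := by
  induction t with
  | zero => simp
  | add s t hs ht => simp [hs, ht]
  | tmul v w => simp

variable [FiniteDimensional ℂ X] [FiniteDimensional ℂ Y] [FiniteDimensional ℂ H]

lemma adjoint_tmul_basis (β : X ⊗[ℂ] H →ₗ[ℂ] H ⊗[ℂ] Y) (i : ι) (y : Y) :
    LinearMap.adjoint β (b i ⊗ₜ y) =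
      ∑ j, LinearMap.adjoint (entry b β i j) y ⊗ₜ[ℂ] b j := by
  refine TensorProduct.ext_iff_inner_right.2 fun x h => ?_
  refine (LinearMap.adjoint_inner_left _ _ _).trans ?_
  rw [← b.sum_repr' h]
  simp only [TensorProduct.tmul_sum, TensorProduct.tmul_smul, map_sum, map_smul]
  refine (inner_sum (𝕜 := ℂ) (E := H ⊗[ℂ] Y) _ _ _).trans
    (Eq.trans ?_ (inner_sum (𝕜 := ℂ) (E := X ⊗[ℂ] H) _ _ _).symm)
  refine Finset.sum_congr rfl fun j _ => ?_
  refine (inner_smul_right (𝕜 := ℂ) (E := H ⊗[ℂ] Y) _ _ _).trans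
    (Eq.trans ?_ (inner_smul_right (𝕜 := ℂ) (E := X ⊗[ℂ] H) _ _ _).symm)
  congr 1
  refine (inner_slice (b i) y _).symm.trans ?_
  refine Eq.trans ?_ (sum_inner (𝕜 := ℂ) (E := X ⊗[ℂ] H) _ _ _).symm
  classical
  simp [b.inner_eq_ite, LinearMap.adjoint_inner_left, entry_apply]

lemma isUnitaryMatrix_entry [DecidableEq ι] {β : X ⊗[ℂ] H →ₗ[ℂ] H ⊗[ℂ] Y}
    (h₁ : LinearMap.adjoint β ∘ₗ β = LinearMap.id) (h₂ : β ∘ₗ LinearMap.adjoint β = LinearMap.id) :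
    IsUnitaryMatrix (entry b β) where
  adjoint_comp j k := by
    refine LinearMap.ext fun x => ?_
    have h := LinearMap.congr_fun h₁ (x ⊗ₜ[ℂ] b k)
    rw [LinearMap.comp_apply, apply_tmul_basis b, map_sum] at h
    simp only [adjoint_tmul_basis] at h
    -- The composite lands in X ⊗ H, while `slice` reads off the left leg; hence the swap.
    have h' := congrArg (fun t => slice (b j) (TensorProduct.comm ℂ X H t)) h
    rw [Finset.sum_comm] at h'
    simp only [← TensorProduct.sum_tmul, map_sum, TensorProduct.comm_tmul, slice_sum_tmul,
      LinearMap.id_apply, slice_tmul, b.inner_eq_ite] at h'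
    rw [LinearMap.sum_apply]
    refine h'.trans ?_
    split_ifs <;> simp
  comp_adjoint i j := by
    refine LinearMap.ext fun y => ?_
    have h := LinearMap.congr_fun h₂ (b j ⊗ₜ[ℂ] y)
    rw [LinearMap.comp_apply, adjoint_tmul_basis b, map_sum] at h
    simp only [apply_tmul_basis b β] at h
    have h' := congrArg (fun t => slice (b i) t) h
    rw [Finset.sum_comm] at h'
    simp only [← TensorProduct.tmul_sum, slice_sum_tmul,
      LinearMap.id_apply, slice_tmul, b.inner_eq_ite] at h'
    rw [LinearMap.sum_apply]
    refine h'.trans ?_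
    split_ifs <;> simp

end Entry

section EntryHilb

variable {ι : Type*} [Fintype ι] {H : FHilb} (b : OrthonormalBasis ι ℂ H) {X Y : FHilb}

/-- The matrix entries of a morphism `X ⊗ H ⟶ H ⊗ Y`. -/
def homEntry (β : X ⊗ H ⟶ H ⊗ Y) (i j : ι) : X →ₗ[ℂ] Y := entry b β.lin i j

lemma fromBH_tmul (β : X ⊗ H ⟶ H ⊗ Y) (x : X) (j k : ι) :
    (fromBH b β).lin (x ⊗ₜ[ℂ] (b j ⊗ₜ[ℂ] b k)) = (√(dimension b) : ℂ) • homEntry b β j k x := by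
  classical
  refine congrArg (fun t : Y => (√(dimension b) : ℂ) • t) ?_
  change TensorProduct.lid ℂ Y ((cap b).lin.rTensor Y ((TensorProduct.assoc ℂ H H Y).symm
    (b j ⊗ₜ[ℂ] β.lin (x ⊗ₜ[ℂ] b k)))) = _
  have h : β.lin (x ⊗ₜ[ℂ] b k) = ∑ i, b i ⊗ₜ[ℂ] homEntry b β i k x := apply_tmul_basis b β.lin x k
  rw [h, TensorProduct.tmul_sum, map_sum]
  have e : ∀ i, TensorProduct.lid ℂ Y ((cap b).lin.rTensor Y ((TensorProduct.assoc ℂ H H Y).symm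
      (b j ⊗ₜ[ℂ] (b i ⊗ₜ[ℂ] homEntry b β i k x)))) =
      (∑ l, ⟪b l, b j⟫_ℂ * ⟪b l, b i⟫_ℂ) • homEntry b β i k x := by
    intro i
    rw [← cap_tmul]
    rfl
  refine (congrArg (TensorProduct.lid ℂ Y) (map_sum _ _ _)).trans ?_
  refine (map_sum _ _ _).trans ?_
  simp only [e]
  simp [b.inner_eq_ite]

/-- The operator β† takes index i to index j with coefficient a_ij†. Bending both legs exchanges
input and output once more, so the adjoint stands at position (i, j) and not (j, i). -/
lemma homEntry_bendDag (β : X ⊗ H ⟶ H ⊗ Y) (i j : ι) :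
    homEntry b (bendDag b β) i j = LinearMap.adjoint (homEntry b β i j) := by
  classical
  refine LinearMap.ext fun y => ?_
  change slice (b i) (((TensorProduct.rid ℂ X).toLinearMap ∘ₗ (cap b).lin.lTensor X ∘ₗ
    (TensorProduct.assoc ℂ X H H).toLinearMap ∘ₗ (LinearMap.adjoint β.lin).rTensor H ∘ₗ
    (TensorProduct.assoc ℂ H Y H).symm.toLinearMap).lTensor H
      (TensorProduct.assoc ℂ H H (Y ⊗[ℂ] H) ((cup b).lin (1 : ℂ) ⊗ₜ[ℂ] (y ⊗ₜ[ℂ] b j)))) = _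
  rw [cup_one, slice_lTensor, TensorProduct.sum_tmul, map_sum]
  simp only [TensorProduct.assoc_tmul, slice_sum_tmul]
  change TensorProduct.rid ℂ X ((cap b).lin.lTensor X (TensorProduct.assoc ℂ X H H
    (LinearMap.adjoint β.lin (b i ⊗ₜ[ℂ] y) ⊗ₜ[ℂ] b j))) = _
  have h : LinearMap.adjoint β.lin (b i ⊗ₜ[ℂ] y) =
      ∑ k, LinearMap.adjoint (homEntry b β i k) y ⊗ₜ[ℂ] b k := adjoint_tmul_basis b β.lin i y
  rw [h]
  have e : ∀ k, TensorProduct.rid ℂ X ((cap b).lin.lTensor X (TensorProduct.assoc ℂ X H H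
      ((LinearMap.adjoint (homEntry b β i k) y ⊗ₜ[ℂ] b k) ⊗ₜ[ℂ] b j))) =
      (∑ l, ⟪b l, b k⟫_ℂ * ⟪b l, b j⟫_ℂ) • LinearMap.adjoint (homEntry b β i k) y := by
    intro k
    rw [← cap_tmul]
    rfl
  rw [TensorProduct.sum_tmul, map_sum]
  refine (congrArg (TensorProduct.rid ℂ X) (map_sum _ _ _)).trans ?_
  refine (map_sum _ _ _).trans ?_
  simp only [e]
  simp [b.inner_eq_ite]

lemma isUnitaryMatrix_homEntry [DecidableEq ι] {β : X ⊗ H ⟶ H ⊗ Y} (h : IsUnitary β) :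
    IsUnitaryMatrix (homEntry b β) :=
  isUnitaryMatrix_entry b (congrArg FHilb.Hom.lin h.1) (congrArg FHilb.Hom.lin h.2)

end EntryHilb

/-! ### Maps out of `X ⊗ B(H)` given by matrices of operators -/

section LinearFromMatrix

variable {X Y Z H : Type} [NormedAddCommGroup X] [InnerProductSpace ℂ X]
  [NormedAddCommGroup Y] [InnerProductSpace ℂ Y] [AddCommGroup Z] [Module ℂ Z]
  [NormedAddCommGroup H] [InnerProductSpace ℂ H]
  {ι : Type*} [Fintype ι] (b : OrthonormalBasis ι ℂ H)

lemma ext_tmul_basis {f g : X ⊗[ℂ] (H ⊗[ℂ] H) →ₗ[ℂ] Z}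
    (h : ∀ x j k, f (x ⊗ₜ (b j ⊗ₜ b k)) = g (x ⊗ₜ (b j ⊗ₜ b k))) : f = g := by
  refine TensorProduct.ext (LinearMap.ext fun x => TensorProduct.ext ?_)
  refine b.toBasis.ext fun j => b.toBasis.ext fun k => ?_
  simpa using h x j k

variable {b} {a : ι → ι → X →ₗ[ℂ] Y} {c : ℂ} {w : X ⊗[ℂ] (H ⊗[ℂ] H) →ₗ[ℂ] Y}

lemma map_shuffle_of_matrix (hw : ∀ x j k, w (x ⊗ₜ (b j ⊗ₜ b k)) = c • a j k x)
    (s : X ⊗[ℂ] X) (i j k l : ι) :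
    TensorProduct.map w w (tensorTensorTensorComm ℂ X X (H ⊗[ℂ] H) (H ⊗[ℂ] H)
      (s ⊗ₜ ((b i ⊗ₜ b j) ⊗ₜ (b k ⊗ₜ b l)))) =
      (c * c) • TensorProduct.map (a i j) (a k l) s := by
  induction s with
  | zero => simp
  | add s t hs ht => rw [TensorProduct.add_tmul, map_add, map_add, hs, ht, map_add, smul_add]
  | tmul x y => simp [hw, ← TensorProduct.smul_tmul', smul_smul]

lemma lTensor_shuffle_of_matrix (hw : ∀ x j k, w (x ⊗ₜ (b j ⊗ₜ b k)) = c • a j k x)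
    (s : X ⊗[ℂ] X) (i j k l : ι) :
    w.lTensor (X ⊗[ℂ] (H ⊗[ℂ] H)) (tensorTensorTensorComm ℂ X X (H ⊗[ℂ] H) (H ⊗[ℂ] H)
      (s ⊗ₜ ((b i ⊗ₜ b j) ⊗ₜ (b k ⊗ₜ b l)))) =
      c • ((TensorProduct.mk ℂ X (H ⊗[ℂ] H)).flip (b i ⊗ₜ b j)).rTensor Y
        ((a k l).lTensor X s) := by
  induction s with
  | zero => simp
  | add s t hs ht =>
    rw [TensorProduct.add_tmul, map_add, map_add, hs, ht, map_add, map_add, smul_add]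
  | tmul x y => simp [hw]

end LinearFromMatrix

section AdjointFromMatrix

variable {X Y K : Type} [NormedAddCommGroup X] [InnerProductSpace ℂ X] [FiniteDimensional ℂ X]
  [NormedAddCommGroup Y] [InnerProductSpace ℂ Y] [FiniteDimensional ℂ Y]
  [NormedAddCommGroup K] [InnerProductSpace ℂ K] [FiniteDimensional ℂ K]
  {κ : Type*} [Fintype κ] {e : OrthonormalBasis κ ℂ K} {a : κ → X →ₗ[ℂ] Y} {c : ℂ}
  {w : X ⊗[ℂ] K →ₗ[ℂ] Y}

/-- The scalar must be real because the adjoint conjugates it; it will be √d. -/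
lemma adjoint_of_family (hw : ∀ x q, w (x ⊗ₜ e q) = c • a q x) (hc : star c = c)
    (y : Y) : LinearMap.adjoint w y = c • ∑ q, LinearMap.adjoint (a q) y ⊗ₜ[ℂ] e q := by
  refine TensorProduct.ext_iff_inner_right.2 fun x h => ?_
  refine (LinearMap.adjoint_inner_left _ _ _).trans ?_
  refine Eq.trans ?_ (inner_smul_left (𝕜 := ℂ) (E := X ⊗[ℂ] K) _ _ _).symm
  refine Eq.trans ?_ (congrArg _ (sum_inner (𝕜 := ℂ) (E := X ⊗[ℂ] K) _ _ _).symm)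
  conv_lhs => rw [← e.sum_repr' h]
  have hc' : (starRingEnd ℂ) c = c := hc
  simp only [TensorProduct.tmul_sum, TensorProduct.tmul_smul, map_sum, map_smul, hw, inner_sum,
    inner_smul_right, hc', TensorProduct.inner_tmul, LinearMap.adjoint_inner_left, Finset.mul_sum]
  refine Finset.sum_congr rfl fun q _ => ?_
  ring

lemma rTensor_adjoint_of_family (hw : ∀ x q, w (x ⊗ₜ e q) = c • a q x) (hc : star c = c)
    (t : Y ⊗[ℂ] Y) : (LinearMap.adjoint w).rTensor Y t =
      c • ∑ q, ((TensorProduct.mk ℂ X K).flip (e q)).rTensor Y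
        ((LinearMap.adjoint (a q)).rTensor Y t) := by
  induction t with
  | zero => simp
  | add s t hs ht =>
    rw [map_add, hs, ht]
    simp only [map_add, Finset.sum_add_distrib, smul_add]
  | tmul y z =>
    rw [LinearMap.rTensor_tmul, adjoint_of_family hw hc, ← TensorProduct.smul_tmul',
      TensorProduct.sum_tmul]
    rfl

end AdjointFromMatrix

/-! ### Matrix conditions for a map out of A ⊗ B(H) to preserve comultiplication, counit and cup. -/

section FromMatrix

variable {ι : Type*} [Fintype ι] {H : FHilb} {b : OrthonormalBasis ι ℂ H}
  {A B : Mon FHilb} {a : ι → ι → A.X →ₗ[ℂ] B.X}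
  {w : A.X ⊗ (H ⊗ H) ⟶ B.X}

lemma comul_tensor_bh_tmul [Nonempty ι] (x : A.X) (j k : ι) :
    (comul (A ⊗ bh b)).lin (x ⊗ₜ[ℂ] (b j ⊗ₜ[ℂ] b k)) =
      ((1 / √(dimension b) : ℝ) : ℂ) • ∑ l, tensorTensorTensorComm ℂ A.X A.X (H ⊗[ℂ] H) (H ⊗[ℂ] H)
        ((comul A).lin x ⊗ₜ[ℂ] ((b j ⊗ₜ[ℂ] b l) ⊗ₜ[ℂ] (b l ⊗ₜ[ℂ] b k))) := by
  rw [comul_tensor_lin]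
  change tensorTensorTensorComm ℂ A.X A.X (H ⊗[ℂ] H) (H ⊗[ℂ] H)
    ((comul A).lin x ⊗ₜ[ℂ] (dag (bhMul b)).lin (b j ⊗ₜ[ℂ] b k)) = _
  rw [dag_bhMul_tmul, TensorProduct.tmul_smul, TensorProduct.tmul_sum]
  refine (map_smul _ _ _).trans ?_
  congr 1
  exact map_sum _ _ _

/-- The index l inserted by the comultiplication of `B(H)` is the summation index of the matrix
product. The scalars agree since d^(-1/2) · √d · √d = √d. -/
lemma comp_comul_of_matrix [Nonempty ι]
    (hw : ∀ x j k, w.lin (x ⊗ₜ[ℂ] (b j ⊗ₜ[ℂ] b k)) = (√(dimension b) : ℂ) • a j k x)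
    (hc : ∀ i j x, (comul B).lin (a i j x) =
      ∑ k, TensorProduct.map (a i k) (a k j) ((comul A).lin x)) :
    w ≫ comul B = comul (A ⊗ bh b) ≫ (w ⊗ₘ w) := by
  refine FHilb.hom_ext (ext_tmul_basis b fun x j k => ?_)
  change (comul B).lin (w.lin (x ⊗ₜ[ℂ] (b j ⊗ₜ[ℂ] b k))) = TensorProduct.map w.lin w.lin
    ((comul (A ⊗ bh b)).lin (x ⊗ₜ[ℂ] (b j ⊗ₜ[ℂ] b k)))
  rw [hw]
  refine (map_smul _ _ _).trans ?_
  rw [hc]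
  refine Eq.trans ?_ (congrArg (TensorProduct.map w.lin w.lin) (comul_tensor_bh_tmul x j k)).symm
  refine Eq.trans ?_ (map_smul (TensorProduct.map w.lin w.lin) _ _).symm
  rw [Finset.smul_sum]
  refine Eq.trans ?_ (congrArg _ (map_sum (TensorProduct.map w.lin w.lin) _ _).symm)
  refine Eq.trans ?_ (congrArg _ (Finset.sum_congr rfl fun l _ =>
    (map_shuffle_of_matrix hw ((comul A).lin x) j l l k).symm))
  rw [← Finset.smul_sum, ← Finset.smul_sum]
  refine Eq.trans ?_ (smul_smul _ _ _).symm
  congr 1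
  linear_combination -(√(dimension b) : ℂ) * sqrt_dim_mul b

/-- The counit of `B(H)` is √d times the cap, whose value δ_jk matches the counit rule for the
entries. -/
lemma comp_counit_of_matrix [DecidableEq ι] [Nonempty ι]
    (hw : ∀ x j k, w.lin (x ⊗ₜ[ℂ] (b j ⊗ₜ[ℂ] b k)) = (√(dimension b) : ℂ) • a j k x)
    (hu : ∀ i j x, (counit B).lin (a i j x) = if i = j then (counit A).lin x else (0 : ℂ)) :
    w ≫ counit B = counit (A ⊗ bh b) := by
  refine FHilb.hom_ext (ext_tmul_basis b fun x j k => ?_)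
  rw [counit_tensor]
  change (counit B).lin (w.lin (x ⊗ₜ[ℂ] (b j ⊗ₜ[ℂ] b k))) =
    HMul.hMul (α := ℂ) (β := ℂ) ((counit A).lin x) ((dag (bhOne b)).lin (b j ⊗ₜ[ℂ] b k))
  rw [hw, dag_bhOne_tmul]
  refine (map_smul _ _ _).trans ?_
  rw [hu]
  refine (smul_eq_mul (_ : ℂ) (_ : ℂ)).trans ?_
  rcases eq_or_ne j k with rfl | h
  · simp [b.inner_eq_ite]
    ring
  · simp [b.inner_eq_ite, h, Ne.symm h]

/-- The factor √d of the unit cancels d^(-1/2) from the comultiplication. The two copies of `B(H)`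
carry transposed index pairs, reflecting the matrix adjoint as involution. -/
lemma frobCup_tensor_bh [Nonempty ι] : (frobCup (A ⊗ bh b)).lin (1 : ℂ) =
    ∑ i, ∑ l, tensorTensorTensorComm ℂ A.X A.X (H ⊗[ℂ] H) (H ⊗[ℂ] H)
      ((frobCup A).lin (1 : ℂ) ⊗ₜ[ℂ] ((b i ⊗ₜ[ℂ] b l) ⊗ₜ[ℂ] (b l ⊗ₜ[ℂ] b i))) := by
  change (comul (A ⊗ bh b)).lin ((one A).lin (1 : ℂ) ⊗ₜ[ℂ] (bhOne b).lin (1 : ℂ)) = _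
  have h1 : (bhOne b).lin (1 : ℂ) = (√(dimension b) : ℂ) • ∑ i, b i ⊗ₜ[ℂ] b i :=
    congrArg _ (cup_one b)
  have h2 : (dag (bhMul b)).lin ((√(dimension b) : ℂ) • ∑ i, b i ⊗ₜ[ℂ] b i) =
      ∑ i, ∑ l, (b i ⊗ₜ[ℂ] b l) ⊗ₜ[ℂ] (b l ⊗ₜ[ℂ] b i) := by
    refine (map_smul (dag (bhMul b)).lin _ _).trans ?_
    refine (congrArg _ (map_sum (dag (bhMul b)).lin _ _)).trans ?_
    refine (congrArg _ (Finset.sum_congr rfl fun i _ => dag_bhMul_tmul b (b i) (b i))).trans ?_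
    rw [← Finset.smul_sum]
    refine (smul_smul _ _ _).trans ?_
    rw [mul_comm, sqrt_dim_mul]
    exact one_smul _ _
  rw [comul_tensor_lin, h1]
  change tensorTensorTensorComm ℂ A.X A.X (H ⊗[ℂ] H) (H ⊗[ℂ] H)
    ((frobCup A).lin (1 : ℂ) ⊗ₜ[ℂ] (dag (bhMul b)).lin ((√(dimension b) : ℂ) • ∑ i, b i ⊗ₜ[ℂ] b i))
      = _
  rw [h2]
  simp only [TensorProduct.tmul_sum, map_sum]

/-- The transposed pairs in the cup of `B(H)` are why `hcup` couples the entry (j, k) with the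
adjoint of the entry (k, j). Comparing coefficients of each basis vector of H ⊗ H then reduces the
claim to `hcup`. -/
lemma frobCup_of_matrix [Nonempty ι]
    (hw : ∀ x j k, w.lin (x ⊗ₜ[ℂ] (b j ⊗ₜ[ℂ] b k)) = (√(dimension b) : ℂ) • a j k x)
    (hcup : ∀ j k, (a j k).lTensor A.X ((frobCup A).lin (1 : ℂ)) =
      (LinearMap.adjoint (a k j)).rTensor B.X ((frobCup B).lin (1 : ℂ))) :
    frobCup (A ⊗ bh b) ≫ (A ⊗ bh b).X ◁ w = frobCup B ≫ dag w ▷ B.X := by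
  refine FHilb.hom_ext (LinearMap.ext_ring ?_)
  change w.lin.lTensor (A.X ⊗[ℂ] (H ⊗[ℂ] H)) ((frobCup (A ⊗ bh b)).lin (1 : ℂ)) =
    (LinearMap.adjoint w.lin).rTensor B.X ((frobCup B).lin (1 : ℂ))
  have hw' : ∀ (x : A.X) (q : ι × ι), w.lin (x ⊗ₜ[ℂ] b.tensorProduct b q) =
      (√(dimension b) : ℂ) • a q.1 q.2 x := fun x q => by
    rw [OrthonormalBasis.tensorProduct_apply']
    exact hw x q.1 q.2
  refine Eq.trans ?_ (rTensor_adjoint_of_family hw' (Complex.conj_ofReal _) _).symm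
  rw [frobCup_tensor_bh, Fintype.sum_prod_type]
  refine (map_sum _ _ _).trans ?_
  rw [Finset.smul_sum]
  refine Finset.sum_congr rfl fun i _ => ?_
  refine (map_sum _ _ _).trans ?_
  rw [Finset.smul_sum]
  refine Finset.sum_congr rfl fun l _ => ?_
  rw [← hcup, OrthonormalBasis.tensorProduct_apply]
  exact lTensor_shuffle_of_matrix hw _ i l l i

end FromMatrix

/-! ### Matrix entries of unitary pseudonatural transformations -/

lemma slice_assoc_tmul {H M N : Type} [NormedAddCommGroup H] [InnerProductSpace ℂ H]
    [AddCommGroup M] [Module ℂ M] [AddCommGroup N] [Module ℂ N] (h : H) (t : H ⊗[ℂ] M) (n : N) :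
    slice h (TensorProduct.assoc ℂ H M N (t ⊗ₜ n)) = slice h t ⊗ₜ[ℂ] n := by
  induction t with
  | zero => simp
  | add s t hs ht => simp [TensorProduct.add_tmul, hs, ht]
  | tmul v w => simp [TensorProduct.smul_tmul']

lemma slice_sum {H M : Type} [NormedAddCommGroup H] [InnerProductSpace ℂ H]
    [AddCommGroup M] [Module ℂ M] {ι : Type*} (s : Finset ι) (h : H) (t : ι → H ⊗[ℂ] M) :
    slice h (∑ i ∈ s, t i) = ∑ i ∈ s, slice h (t i) := by
  simp [slice]

section UPT

open Functor.LaxMonoidal Functor.OplaxMonoidal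

variable {C : Type u} [Category.{v} C] [MonoidalCategory C] [DaggerCategory C]
  [Preadditive C] [Linear ℂ C] {F₁ F₂ : FibreFunctor C} (α : UPT F₁ F₂)
  {ι : Type*} [Fintype ι] (b : OrthonormalBasis ι ℂ α.H)

/-- The operators `a^X_ij : F₁(X) → F₂(X)` with `α_X (x ⊗ |j⟩) = ∑ i, |i⟩ ⊗ a^X_ij x`. -/
def UPT.mat (X : C) (i j : ι) : F₁.functor.obj X →ₗ[ℂ] F₂.functor.obj X :=
  homEntry b (α.app X) i j

lemma UPT.map_mat {X Y : C} (f : X ⟶ Y) (i j : ι) (x : F₁.functor.obj X) :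
    (F₂.functor.map f).lin (α.mat b X i j x) = α.mat b Y i j ((F₁.functor.map f).lin x) := by
  have h := LinearMap.congr_fun (congrArg FHilb.Hom.lin (α.naturality f)) (x ⊗ₜ[ℂ] b j)
  have h' := congrArg (fun t : α.H ⊗[ℂ] F₂.functor.obj Y => slice (b i) t) h
  refine Eq.trans ?_ h'.symm
  exact (slice_lTensor (b i) (F₂.functor.map f).lin ((α.app X).lin (x ⊗ₜ[ℂ] b j))).symm

/-- The leg `H` passes through the component at `Y` and then the one at `X`; expanding it in the
basis in between produces the index k of a matrix product. -/
lemma UPT.mat_μ (X Y : C) (i j : ι) (t : F₁.functor.obj X ⊗[ℂ] F₁.functor.obj Y) :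
    α.mat b (X ⊗ Y) i j ((μ F₁.functor X Y).lin t) =
      (μ F₂.functor X Y).lin (∑ k, TensorProduct.map (α.mat b X i k) (α.mat b Y k j) t) := by
  induction t with
  | zero =>
    simp only [map_zero, Finset.sum_const_zero]
  | add s t hs ht =>
    simp only [map_add, Finset.sum_add_distrib, hs, ht]
  | tmul x y =>
    have h := LinearMap.congr_fun (congrArg FHilb.Hom.lin (α.app_tensor X Y))
      ((x ⊗ₜ[ℂ] y) ⊗ₜ[ℂ] b j)
    have h' := congrArg (fun t : α.H ⊗[ℂ] F₂.functor.obj (X ⊗ Y) => slice (b i) t) h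
    refine h'.trans ?_
    refine (slice_lTensor (b i) (μ F₂.functor X Y).lin _).trans ?_
    refine congrArg (μ F₂.functor X Y).lin ?_
    change slice (b i) (TensorProduct.assoc ℂ α.H (F₂.functor.obj X) (F₂.functor.obj Y)
      ((α.app X).lin.rTensor (F₂.functor.obj Y)
        ((TensorProduct.assoc ℂ (F₁.functor.obj X) α.H (F₂.functor.obj Y)).symm
          (x ⊗ₜ[ℂ] (α.app Y).lin (y ⊗ₜ[ℂ] b j))))) = _
    have e : (α.app Y).lin (y ⊗ₜ[ℂ] b j) = ∑ k, b k ⊗ₜ[ℂ] α.mat b Y k j y :=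
      apply_tmul_basis b (α.app Y).lin y j
    rw [e]
    simp only [TensorProduct.tmul_sum, map_sum, TensorProduct.assoc_symm_tmul]
    rw [slice_sum]
    exact Finset.sum_congr rfl fun k _ => slice_assoc_tmul _ _ _

lemma UPT.mat_ε [DecidableEq ι] (i j : ι) (c : ℂ) :
    α.mat b (𝟙_ C) i j ((ε F₁.functor).lin c) = if i = j then (ε F₂.functor).lin c else 0 := by
  have h := LinearMap.congr_fun (congrArg FHilb.Hom.lin α.app_unit) (c ⊗ₜ[ℂ] b j)
  have h' := congrArg (fun t : α.H ⊗[ℂ] F₂.functor.obj (𝟙_ C) => slice (b i) t) h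
  refine h'.trans ?_
  change slice (b i) ((c • b j) ⊗ₜ[ℂ] (ε F₂.functor).lin (1 : ℂ)) = _
  rw [slice_tmul, inner_smul_right, b.inner_eq_ite, mul_ite, mul_one, mul_zero, ite_smul, zero_smul]
  split_ifs
  · refine (map_smul (ε F₂.functor).lin c (1 : ℂ)).symm.trans ?_
    exact congrArg (ε F₂.functor).lin (mul_one c)
  · rfl

lemma UPT.isUnitaryMatrix_mat [DecidableEq ι] (X : C) : IsUnitaryMatrix (α.mat b X) :=
  isUnitaryMatrix_homEntry b (α.unitary X)

lemma UPT.mat_δ (X Y : C) (i j : ι) (t : F₁.functor.obj (X ⊗ Y)) :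
    (δ F₂.functor X Y).lin (α.mat b (X ⊗ Y) i j t) =
      ∑ k, TensorProduct.map (α.mat b X i k) (α.mat b Y k j) ((δ F₁.functor X Y).lin t) := by
  have h := α.mat_μ b X Y i j ((δ F₁.functor X Y).lin t)
  have e₁ : (μ F₁.functor X Y).lin ((δ F₁.functor X Y).lin t) = t :=
    LinearMap.congr_fun (congrArg FHilb.Hom.lin (Functor.Monoidal.δ_μ F₁.functor X Y)) t
  rw [e₁] at h
  rw [h]
  exact LinearMap.congr_fun (congrArg FHilb.Hom.lin (Functor.Monoidal.μ_δ F₂.functor X Y)) _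

lemma UPT.mat_η [DecidableEq ι] (i j : ι) (t : F₁.functor.obj (𝟙_ C)) :
    (η F₂.functor).lin (α.mat b (𝟙_ C) i j t) =
      if i = j then (η F₁.functor).lin t else (0 : ℂ) := by
  have h := α.mat_ε b i j ((η F₁.functor).lin t)
  have e₁ : (ε F₁.functor).lin ((η F₁.functor).lin t) = t :=
    LinearMap.congr_fun (congrArg FHilb.Hom.lin (Functor.Monoidal.η_ε F₁.functor)) t
  have e₂ : ∀ c : ℂ, (η F₂.functor).lin ((ε F₂.functor).lin c) = c := fun c =>
    LinearMap.congr_fun (congrArg FHilb.Hom.lin (Functor.Monoidal.ε_η F₂.functor)) c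
  rw [e₁] at h
  rw [h]
  split_ifs
  · exact e₂ _
  · exact map_zero (η F₂.functor).lin

/-! #### Compatibility with the algebra structures -/

variable (A : Mon C)

lemma UPT.comul_mat (i j : ι) (x : F₁.functor.obj A.X) :
    (comul (F₂.mapAlg A)).lin (α.mat b A.X i j x) =
      ∑ k, TensorProduct.map (α.mat b A.X i k) (α.mat b A.X k j)
        ((comul (F₁.mapAlg A)).lin x) := by
  rw [F₁.comul_mapAlg, F₂.comul_mapAlg]
  change (δ F₂.functor A.X A.X).lin ((F₂.functor.map (comul A)).lin (α.mat b A.X i j x)) = _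
  rw [α.map_mat, α.mat_δ]
  rfl

lemma UPT.mat_mul (i j : ι) (t : F₁.functor.obj A.X ⊗[ℂ] F₁.functor.obj A.X) :
    α.mat b A.X i j ((mul (F₁.mapAlg A)).lin t) =
      (mul (F₂.mapAlg A)).lin
        (∑ k, TensorProduct.map (α.mat b A.X i k) (α.mat b A.X k j) t) := by
  rw [F₁.mul_mapAlg, F₂.mul_mapAlg]
  change α.mat b A.X i j ((F₁.functor.map (mul A)).lin ((μ F₁.functor A.X A.X).lin t)) = _
  rw [← α.map_mat, α.mat_μ]
  rfl

lemma UPT.mat_one [DecidableEq ι] (i j : ι) (c : ℂ) :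
    α.mat b A.X i j ((one (F₁.mapAlg A)).lin c) =
      if i = j then (one (F₂.mapAlg A)).lin c else 0 := by
  rw [F₁.one_mapAlg, F₂.one_mapAlg]
  change α.mat b A.X i j ((F₁.functor.map (one A)).lin ((ε F₁.functor).lin c)) = _
  rw [← α.map_mat, α.mat_ε]
  split_ifs
  · rfl
  · exact map_zero _

lemma UPT.counit_mat [DecidableEq ι] (i j : ι) (x : F₁.functor.obj A.X) :
    (counit (F₂.mapAlg A)).lin (α.mat b A.X i j x) =
      if i = j then (counit (F₁.mapAlg A)).lin x else (0 : ℂ) := by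
  rw [F₁.counit_mapAlg, F₂.counit_mapAlg]
  change (η F₂.functor).lin ((F₂.functor.map (counit A)).lin (α.mat b A.X i j x)) = _
  rw [α.map_mat, α.mat_η]
  rfl

/-- The cup is the comultiplication of the unit, so this is `UPT.comul_mat` evaluated at the unit,
which the diagonal entries preserve and the others kill. -/
lemma UPT.sum_map_mat_frobCup [DecidableEq ι] (i j : ι) :
    ∑ k, TensorProduct.map (α.mat b A.X i k) (α.mat b A.X k j)
      ((frobCup (F₁.mapAlg A)).lin (1 : ℂ)) =
      if i = j then (frobCup (F₂.mapAlg A)).lin (1 : ℂ) else 0 := by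
  refine (α.comul_mat b A i j ((one (F₁.mapAlg A)).lin (1 : ℂ))).symm.trans ?_
  rw [α.mat_one]
  split_ifs
  · rfl
  · exact map_zero _

end UPT

/-! ### Adjoints of the relations between matrix entries -/

section AdjointRelations

variable {V W : Type} [NormedAddCommGroup V] [InnerProductSpace ℂ V] [FiniteDimensional ℂ V]
  [NormedAddCommGroup W] [InnerProductSpace ℂ W] [FiniteDimensional ℂ W]
  {ι : Type*} [Fintype ι]

/-- Compatibility of v with comultiplication is the Hermitian adjoint of the compatibility of the
entries with multiplication; the order of the summation index is kept. -/
lemma adjoint_comul_of_mul {a : V →ₗ[ℂ] W} {p q : ι → V →ₗ[ℂ] W} {m : V ⊗[ℂ] V →ₗ[ℂ] V}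
    {n : W ⊗[ℂ] W →ₗ[ℂ] W} (h : ∀ t, a (m t) = n (∑ k, TensorProduct.map (p k) (q k) t)) (y : W) :
    LinearMap.adjoint m (LinearMap.adjoint a y) =
      ∑ k, TensorProduct.map (LinearMap.adjoint (p k)) (LinearMap.adjoint (q k))
        (LinearMap.adjoint n y) := by
  have e : a ∘ₗ m = n ∘ₗ ∑ k, TensorProduct.map (p k) (q k) := by
    refine LinearMap.ext fun t => ?_
    rw [LinearMap.comp_apply, LinearMap.comp_apply, h, LinearMap.sum_apply]
  have e' := LinearMap.congr_fun (congrArg LinearMap.adjoint e) y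
  rw [LinearMap.adjoint_comp, LinearMap.adjoint_comp, map_sum] at e'
  simp only [TensorProduct.adjoint_map] at e'
  refine e'.trans ?_
  rw [LinearMap.comp_apply, LinearMap.sum_apply]

lemma adjoint_counit_of_one {a : V →ₗ[ℂ] W} {p : ℂ →ₗ[ℂ] V} {q : ℂ →ₗ[ℂ] W} {P : Prop}
    [Decidable P] (h : ∀ c, a (p c) = if P then q c else 0) (y : W) :
    LinearMap.adjoint p (LinearMap.adjoint a y) = if P then LinearMap.adjoint q y else 0 := by
  have e : a ∘ₗ p = if P then q else 0 := by
    refine LinearMap.ext fun t => ?_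
    rw [LinearMap.comp_apply, h]
    split_ifs <;> rfl
  have e' := LinearMap.congr_fun (congrArg LinearMap.adjoint e) y
  rw [LinearMap.adjoint_comp] at e'
  refine e'.trans ?_
  split_ifs
  · rfl
  · rw [map_zero, LinearMap.zero_apply]

end AdjointRelations

/-! ### The main theorem -/

/-- The maximally entangled state feeds the same pair (j, k) to both maps, so the composite is a
multiple of ∑ a_jk a'_jk. -/
lemma entComp_eq_id {ι : Type*} [Fintype ι] [Nonempty ι] {H : FHilb} {b : OrthonormalBasis ι ℂ H}
    {X Y : FHilb} {w' : X ⊗ (H ⊗ H) ⟶ Y} {w : Y ⊗ (H ⊗ H) ⟶ X} {a' : ι → ι → X →ₗ[ℂ] Y}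
    {a : ι → ι → Y →ₗ[ℂ] X}
    (hw' : ∀ x j k, w'.lin (x ⊗ₜ[ℂ] (b j ⊗ₜ[ℂ] b k)) = (√(dimension b) : ℂ) • a' j k x)
    (hw : ∀ x j k, w.lin (x ⊗ₜ[ℂ] (b j ⊗ₜ[ℂ] b k)) = (√(dimension b) : ℂ) • a j k x)
    (h : ∑ j, ∑ k, a j k ∘ₗ a' j k = (Fintype.card ι : ℂ) • LinearMap.id) :
    entComp b w' w = 𝟙 X := by
  refine FHilb.hom_ext (LinearMap.ext fun x => ?_)
  change w.lin (w'.lin.rTensor (H ⊗[ℂ] H) ((TensorProduct.assoc ℂ X (H ⊗[ℂ] H) (H ⊗[ℂ] H)).symm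
    (x ⊗ₜ[ℂ] ((1 : ℂ) • (((1 / (dimension b) ^ 2 : ℝ) : ℂ) •
      ∑ i, ∑ j, (b i ⊗ₜ[ℂ] b j) ⊗ₜ[ℂ] (b i ⊗ₜ[ℂ] b j)))))) = x
  rw [one_smul]
  have e : ∀ i j, w.lin (w'.lin.rTensor (H ⊗[ℂ] H)
      ((TensorProduct.assoc ℂ X (H ⊗[ℂ] H) (H ⊗[ℂ] H)).symm
      (x ⊗ₜ[ℂ] ((b i ⊗ₜ[ℂ] b j) ⊗ₜ[ℂ] (b i ⊗ₜ[ℂ] b j))))) =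
      ((√(dimension b) : ℂ) * (√(dimension b) : ℂ)) • (a i j ∘ₗ a' i j) x := by
    intro i j
    change w.lin (w'.lin (x ⊗ₜ[ℂ] (b i ⊗ₜ[ℂ] b j)) ⊗ₜ[ℂ] (b i ⊗ₜ[ℂ] b j)) = _
    rw [hw', hw, map_smul, smul_smul]
    rfl
  let φ : (H ⊗[ℂ] H) ⊗[ℂ] (H ⊗[ℂ] H) →ₗ[ℂ] X := w.lin ∘ₗ w'.lin.rTensor (H ⊗[ℂ] H) ∘ₗ
    (TensorProduct.assoc ℂ X (H ⊗[ℂ] H) (H ⊗[ℂ] H)).symm.toLinearMap ∘ₗ TensorProduct.mk ℂ X _ x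
  change φ _ = x
  have e' : ∀ i j, φ ((b i ⊗ₜ[ℂ] b j) ⊗ₜ[ℂ] (b i ⊗ₜ[ℂ] b j)) =
      ((√(dimension b) : ℂ) * (√(dimension b) : ℂ)) • (a i j ∘ₗ a' i j) x := e
  simp only [map_smul, map_sum, e', ← Finset.smul_sum, ← LinearMap.sum_apply, h]
  rw [LinearMap.smul_apply, smul_smul, smul_smul, ← Complex.ofReal_mul,
    Real.mul_self_sqrt (Nat.cast_nonneg _)]
  have hd : (Fintype.card ι : ℂ) ≠ 0 := Nat.cast_ne_zero.2 Fintype.card_ne_zero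
  -- The scalars are d⁻² from the state, √d · √d from the two maps and d from `h`.
  have : ((1 / (dimension b) ^ 2 : ℝ) : ℂ) * (((dimension b : ℝ) : ℂ) * (Fintype.card ι : ℂ)) = 1 := by
    push_cast
    field_simp
  rw [mul_assoc, this]
  exact one_smul ℂ x

section Main

variable {C : Type u} [Category.{v} C] [MonoidalCategory C] [DaggerCategory C]
  [Preadditive C] [Linear ℂ C] {F₁ F₂ : FibreFunctor C} (α : UPT F₁ F₂)
  {ι : Type*} [Fintype ι] (b : OrthonormalBasis ι ℂ α.H)

lemma UPT.u_tmul (A : Mon C) (x : F₁.functor.obj A.X) (j k : ι) :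
    (α.u b A).lin (x ⊗ₜ[ℂ] (b j ⊗ₜ[ℂ] b k)) = (√(dimension b) : ℂ) • α.mat b A.X j k x :=
  fromBH_tmul b (α.app A.X) x j k

lemma UPT.v_tmul (A : Mon C) (y : F₂.functor.obj A.X) (j k : ι) :
    (α.v b A).lin (y ⊗ₜ[ℂ] (b j ⊗ₜ[ℂ] b k)) =
      (√(dimension b) : ℂ) • LinearMap.adjoint (α.mat b A.X j k) y := by
  refine (fromBH_tmul b (α.dualApp b A.X) y j k).trans ?_
  rw [UPT.dualApp, homEntry_bendDag]
  rfl

lemma UPT.u_isStarCohom_and_isChannel [Nonempty ι] {A : Mon C} (hA : IsSpecialFrobenius A) :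
    IsStarCohom (F₁.mapAlg A ⊗ bh b) (F₂.mapAlg A) (α.u b A) ∧
      IsChannel (F₁.mapAlg A ⊗ bh b) (F₂.mapAlg A) (α.u b A) := by
  classical
  have h₁ := F₁.isSpecialFrobenius_mapAlg hA
  have h₂ := F₂.isSpecialFrobenius_mapAlg hA
  have hc := comp_comul_of_matrix (A := F₁.mapAlg A) (B := F₂.mapAlg A) (w := α.u b A)
    (α.u_tmul b A) (α.comul_mat b A)
  have hu := comp_counit_of_matrix (A := F₁.mapAlg A) (B := F₂.mapAlg A) (w := α.u b A)
    (α.u_tmul b A) (α.counit_mat b A)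
  have hs := frobCup_of_matrix (A := F₁.mapAlg A) (B := F₂.mapAlg A) (w := α.u b A)
    (α.u_tmul b A)
    ((α.isUnitaryMatrix_mat b A.X).lTensor_eq_rTensor_adjoint (α.sum_map_mat_frobCup b A))
  exact ⟨isStarCohom_of_cup h₂.frobenius hc hu hs,
    isCP_of_cup (h₁.tensor (isSpecialFrobenius_bh b)).frobenius h₂ hc hs, hu⟩

/-- The coalgebra conditions are adjoint to the algebra rules for the entries. The cup condition is
the second transposition relation, the one obtained by comparing norms. -/
lemma UPT.v_isStarCohom_and_isChannel [Nonempty ι] {A : Mon C} (hA : IsSpecialFrobenius A) :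
    IsStarCohom (F₂.mapAlg A ⊗ bh b) (F₁.mapAlg A) (α.v b A) ∧
      IsChannel (F₂.mapAlg A ⊗ bh b) (F₁.mapAlg A) (α.v b A) := by
  classical
  have h₁ := F₁.isSpecialFrobenius_mapAlg hA
  have h₂ := F₂.isSpecialFrobenius_mapAlg hA
  have hc := comp_comul_of_matrix (A := F₂.mapAlg A) (B := F₁.mapAlg A) (w := α.v b A)
    (α.v_tmul b A) (fun i j y => adjoint_comul_of_mul (α.mat_mul b A i j) y)
  have hu := comp_counit_of_matrix (A := F₂.mapAlg A) (B := F₁.mapAlg A) (w := α.v b A)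
    (α.v_tmul b A) (fun i j y => adjoint_counit_of_one (α.mat_one b A i j) y)
  have hs := frobCup_of_matrix (A := F₂.mapAlg A) (B := F₁.mapAlg A) (w := α.v b A)
    (α.v_tmul b A)
    ((α.isUnitaryMatrix_mat b A.X).lTensor_adjoint_eq_rTensor (α.sum_map_mat_frobCup b A))
  exact ⟨isStarCohom_of_cup h₁.frobenius hc hu hs,
    isCP_of_cup (h₂.tensor (isSpecialFrobenius_bh b)).frobenius h₁ hc hs, hu⟩

lemma UPT.entComp_u_v [Nonempty ι] (A : Mon C) : entComp b (α.u b A) (α.v b A) = 𝟙 _ := by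
  classical
  exact entComp_eq_id (α.u_tmul b A) (α.v_tmul b A) (α.isUnitaryMatrix_mat b A.X).sum_adjoint_comp

lemma UPT.entComp_v_u [Nonempty ι] (A : Mon C) : entComp b (α.v b A) (α.u b A) = 𝟙 _ := by
  classical
  exact entComp_eq_id (α.v_tmul b A) (α.u_tmul b A) (α.isUnitaryMatrix_mat b A.X).sum_comp_adjoint

lemma UPT.u_naturality {A₁ A₂ : Mon C} (f : A₁.X ⟶ A₂.X) :
    α.u b A₁ ≫ F₂.functor.map f = F₁.functor.map f ▷ (α.H ⊗ α.H) ≫ α.u b A₂ := by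
  refine FHilb.hom_ext (ext_tmul_basis b fun x j k => ?_)
  change (F₂.functor.map f).lin ((α.u b A₁).lin (x ⊗ₜ[ℂ] (b j ⊗ₜ[ℂ] b k))) =
    (α.u b A₂).lin ((F₁.functor.map f).lin x ⊗ₜ[ℂ] (b j ⊗ₜ[ℂ] b k))
  rw [α.u_tmul, α.u_tmul, map_smul, α.map_mat]

/-- Naturality at the dagger of `f`, after taking adjoints; both functors preserve daggers. -/
lemma UPT.map_adjoint_mat {X Y : C} (f : X ⟶ Y) (i j : ι) (y : F₂.functor.obj X) :
    (F₁.functor.map f).lin (LinearMap.adjoint (α.mat b X i j) y) =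
      LinearMap.adjoint (α.mat b Y i j) ((F₂.functor.map f).lin y) := by
  have e : (F₂.functor.map (dag f)).lin ∘ₗ α.mat b Y i j =
      α.mat b X i j ∘ₗ (F₁.functor.map (dag f)).lin :=
    LinearMap.ext fun x => α.map_mat b (dag f) i j x
  have e' := LinearMap.congr_fun (congrArg LinearMap.adjoint e) y
  rw [LinearMap.adjoint_comp, LinearMap.adjoint_comp, F₁.map_dag, F₂.map_dag, FHilb.dag_lin,
    FHilb.dag_lin, LinearMap.adjoint_adjoint, LinearMap.adjoint_adjoint] at e'
  exact e'.symm

lemma UPT.v_naturality {A₁ A₂ : Mon C} (f : A₁.X ⟶ A₂.X) :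
    α.v b A₁ ≫ F₁.functor.map f = F₂.functor.map f ▷ (α.H ⊗ α.H) ≫ α.v b A₂ := by
  refine FHilb.hom_ext (ext_tmul_basis b fun y j k => ?_)
  change (F₁.functor.map f).lin ((α.v b A₁).lin (y ⊗ₜ[ℂ] (b j ⊗ₜ[ℂ] b k))) =
    (α.v b A₂).lin ((F₂.functor.map f).lin y ⊗ₜ[ℂ] (b j ⊗ₜ[ℂ] b k))
  rw [α.v_tmul, α.v_tmul, map_smul, α.map_adjoint_mat]

end Main
end EntSymm
end

/-- `Nonempty ι` expresses that the Hilbert space of the transformation is nonzero. -/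
theorem mainTheorem2 {𝒜 : Type*} [Ring 𝒜] [StarRing 𝒜] [HopfAlgebra ℂ 𝒜] [StarModule ℂ 𝒜]
    [EntSymm.CompactQuantumGroupAlgebra 𝒜]
    (F' : EntSymm.FibreFunctor (EntSymm.Corep 𝒜))
    (α : EntSymm.UPT (EntSymm.canonicalFibreFunctor 𝒜) F')
    {ι : Type*} [Fintype ι] [Nonempty ι] (b : OrthonormalBasis ι ℂ α.H) :
    (∀ A : Mon (EntSymm.Corep 𝒜), EntSymm.IsSSFA A →
      EntSymm.IsSpecialFrobenius ((EntSymm.canonicalFibreFunctor 𝒜).mapAlg A) ∧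
      EntSymm.IsSpecialFrobenius (F'.mapAlg A) ∧
      EntSymm.IsSpecialFrobenius (EntSymm.bh b) ∧
      EntSymm.IsSpecialFrobenius ((EntSymm.canonicalFibreFunctor 𝒜).mapAlg A ⊗ EntSymm.bh b) ∧
      EntSymm.IsSpecialFrobenius (F'.mapAlg A ⊗ EntSymm.bh b) ∧
      EntSymm.IsStarCohom ((EntSymm.canonicalFibreFunctor 𝒜).mapAlg A ⊗ EntSymm.bh b)
        (F'.mapAlg A) (α.u b A) ∧
      EntSymm.IsChannel ((EntSymm.canonicalFibreFunctor 𝒜).mapAlg A ⊗ EntSymm.bh b)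
        (F'.mapAlg A) (α.u b A) ∧
      EntSymm.IsStarCohom (F'.mapAlg A ⊗ EntSymm.bh b)
        ((EntSymm.canonicalFibreFunctor 𝒜).mapAlg A) (α.v b A) ∧
      EntSymm.IsChannel (F'.mapAlg A ⊗ EntSymm.bh b)
        ((EntSymm.canonicalFibreFunctor 𝒜).mapAlg A) (α.v b A) ∧
      EntSymm.entComp b (α.u b A) (α.v b A) = 𝟙 _ ∧
      EntSymm.entComp b (α.v b A) (α.u b A) = 𝟙 _) ∧
    (∀ A₁ A₂ : Mon (EntSymm.Corep 𝒜), EntSymm.IsSSFA A₁ → EntSymm.IsSSFA A₂ →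
      ∀ f : A₁.X ⟶ A₂.X, EntSymm.IsCP A₁ A₂ f →
        α.u b A₁ ≫ F'.functor.map f =
          (EntSymm.canonicalFibreFunctor 𝒜).functor.map f ▷ (α.H ⊗ α.H) ≫ α.u b A₂ ∧
        α.v b A₁ ≫ (EntSymm.canonicalFibreFunctor 𝒜).functor.map f =
          F'.functor.map f ▷ (α.H ⊗ α.H) ≫ α.v b A₂) := by
  refine ⟨fun A hA => ?_, fun A₁ A₂ _ _ f _ => ⟨α.u_naturality b f, α.v_naturality b f⟩⟩
  have hA := hA.toIsSpecialFrobenius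
  have h₁ := (EntSymm.canonicalFibreFunctor 𝒜).isSpecialFrobenius_mapAlg hA
  have h₂ := F'.isSpecialFrobenius_mapAlg hA
  have hb := EntSymm.isSpecialFrobenius_bh b
  have hu := α.u_isStarCohom_and_isChannel b hA
  have hv := α.v_isStarCohom_and_isChannel b hA
  exact ⟨h₁, h₂, hb, h₁.tensor hb, h₂.tensor hb, hu.1, hu.2, hv.1, hv.2, α.entComp_u_v b A,
    α.entComp_v_u b A⟩
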